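/- Let $\nu>0$ and let $(\alpha_t)_{t\ge 0}$ be a nonnegative sequence with $\alpha_0=0$ and $\|\alpha\|_1:=\sum_{t}\alpha_t<\infty$. Let $(X_t)_{t\ge0}$ be the discrete Hawkes process with empty history: $X_0=0$ and, for $t\ge1$, conditionally on $X_1,\dots,X_{t-1}$, the variable $X_t$ is Poisson with mean $\lambda_t=\nu+\sum_{s=1}^{t-1}\alpha_sX_{t-s}$. Put $N_t=\sum_{s=1}^tX_s$ and $$I(x)=x\log\Big(\frac{x}{\nu+x\|\alpha\|_1}\Big)-x+x\|\alpha\|_1+\nu\quad(x\ge0),\qquad I(x)=+\infty\quad(x<0).$$ For $z\in\mathbb C$ let $f_s(z)=z+\sum_{i=1}^s\alpha_i\,(e^{f_{s-i}(z)}-1)$ for $s\ge 0$ (so $f_0(z)=z$), $f_\infty(z)=\lim_{s\to\infty}f_s(z)$ and $\eta(z)=\nu\,(e^{f_\infty(z)}-1)$. (a) $I$ is smooth on $(0,\infty)$ and, for every $i\ge2$ and $x>0$, $$I^{(i)}(x)=(i-2)!\,(-1)^{i-2}x^{1-i}\left((i-1)\Big(\frac{\|\alpha\|_1x}{\nu+\|\alpha\|_1x}\Big)^{i}-i\Big(\frac{\|\alpha\|_1x}{\nu+\|\alpha\|_1x}\Big)^{i-1}+1\right).$$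 (b) If $\|\alpha\|_1<1$, then the limit defining $f_\infty(z)$ exists for all $z$ in a neighbourhood of $0$, $\eta$ is analytic at $0$, and $$\eta'(0)=\frac{\nu}{1-\|\alpha\|_1},\qquad \eta''(0)=\frac{\nu}{(1-\|\alpha\|_1)^3}.$$ (c) If $\|\alpha\|_1<1$ and $\sum_{i}i\,\alpha_i<\infty$, then for every integer $m\ge3$ and every real sequence $y=y(t)$ with $y\to\infty$ and $y=o(t^{1/2-1/m})$, as $t\to\infty$ along the positive integers, $$\mathbb P\Big(N_t\ge\frac{\nu}{1-\|\alpha\|_1}t+\sqrt t\,\frac{\sqrt\nu}{(1-\|\alpha\|_1)^{3/2}}\,y\Big)=\frac{1+o(1)}{y\sqrt{2\pi}}\exp\Big(-\sum_{i=2}^{m-1}\frac{I^{(i)}(\eta'(0))}{i!}\,\frac{(\eta''(0))^{i/2}\,y^i}{t^{(i-2)/2}}\Big).$$ -/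

import Mathlib

open MeasureTheory ProbabilityTheory Filter Topology Asymptotics
open scoped NNReal

namespace DiscreteHawkes

/-- The `ℓ¹` norm `∑ αₜ` of a nonnegative summable sequence. -/
noncomputable def l1Norm (α : ℕ → ℝ≥0) : ℝ := ∑' t, (α t : ℝ)

/-- The intensity `λₜ = ν + ∑_{s=1}^{t-1} αₛ x_{t-s}` of a trajectory `x`. -/
noncomputable def intensity (ν : ℝ≥0) (α : ℕ → ℝ≥0) (x : ℕ → ℕ) (t : ℕ) : ℝ≥0 :=
  ν + ∑ s ∈ Finset.Ico 1 t, α s * (x (t - s) : ℝ≥0)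

/-- The σ-algebra generated by `X₁, …, X_{t-1}`. -/
@[reducible] def past {Ω : Type*} (X : ℕ → Ω → ℕ) (t : ℕ) : MeasurableSpace Ω :=
  ⨆ s ∈ Finset.Ico 1 t, MeasurableSpace.comap (X s) ⊤

/-- `X` is a discrete Hawkes process under `P`, with baseline `ν`, excitation function `α` and
empty history: `X₀ = 0`, and for `t ≥ 1`, conditionally on `X₁, …, X_{t-1}`, the variable `Xₜ` has
the Poisson distribution of mean `λₜ`. -/
structure IsHawkes {Ω : Type*} [MeasurableSpace Ω] (P : Measure Ω) (ν : ℝ≥0) (α : ℕ → ℝ≥0)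
    (X : ℕ → Ω → ℕ) : Prop where
  measurable : ∀ t, Measurable (X t)
  zero : ∀ᵐ ω ∂P, X 0 ω = 0
  condPoisson : ∀ t, 1 ≤ t → ∀ k : ℕ,
    P⟦X t ⁻¹' {k} | past X t⟧ =ᵐ[P]
      fun ω => (poissonMeasure (intensity ν α (fun s => X s ω) t)).real {k}

/-- The number of points up to time `t`: `Nₜ = X₁ + ⋯ + Xₜ`. -/
def count {Ω : Type*} (X : ℕ → Ω → ℕ) (t : ℕ) (ω : Ω) : ℕ := ∑ s ∈ Finset.Icc 1 t, X s ω

/-- The rate function `I(x) = x log (x / (ν + x a)) - x + x a + ν` for `x ≥ 0`, and `I(x) = +∞`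
otherwise, where `a` stands for `‖α‖₁`. -/
noncomputable def rate (ν : ℝ≥0) (α : ℕ → ℝ≥0) (x : ℝ) : EReal :=
  if 0 ≤ x then
    ((x * Real.log (x / (ν + x * l1Norm α)) - x + x * l1Norm α + ν : ℝ) : EReal)
  else ⊤

/-- The functions `fₛ(z) = z + ∑_{i=1}^{s} αᵢ (exp (f_{s-i}(z)) - 1)`; the sum is written here in
the index `j = s - i`. In particular `f₀(z) = z`. -/
noncomputable def f (α : ℕ → ℝ≥0) (z : ℂ) (s : ℕ) : ℂ :=
  z + ∑ j : Fin s, ((α (s - j) : ℝ) : ℂ) * (Complex.exp (f α z j) - 1)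
termination_by s
decreasing_by exact j.isLt

theorem f_eq (α : ℕ → ℝ≥0) (z : ℂ) (s : ℕ) :
    f α z s =
      z + ∑ i ∈ Finset.Icc 1 s, ((α i : ℝ) : ℂ) * (Complex.exp (f α z (s - i)) - 1) := by
  rw [f, Fin.sum_univ_eq_sum_range
    (fun j => ((α (s - j) : ℝ) : ℂ) * (Complex.exp (f α z j) - 1)) s]
  congr 1
  refine Finset.sum_nbij' (fun j => s - j) (fun i => s - i) ?_ ?_ ?_ ?_ ?_
  · intro j hj
    simp only [Finset.mem_range, Finset.mem_Icc] at *
    omega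
  · intro j hj
    simp only [Finset.mem_range, Finset.mem_Icc] at *
    omega
  · intro j hj
    simp only [Finset.mem_range] at *
    omega
  · intro j hj
    simp only [Finset.mem_Icc] at *
    omega
  · intro j hj
    simp only [Finset.mem_range] at hj
    rw [Nat.sub_sub_self hj.le]

/-- The pointwise limit `f_∞(z) = lim fₛ(z)`. -/
noncomputable def fInf (α : ℕ → ℝ≥0) (z : ℂ) : ℂ := limUnder atTop (fun s => f α z s)

/-- `η(z) = ν (x(z) - 1)` with `x(z) = exp (f_∞(z))`. -/
noncomputable def eta (ν : ℝ≥0) (α : ℕ → ℝ≥0) (z : ℂ) : ℂ :=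
  ((ν : ℝ) : ℂ) * (Complex.exp (fInf α z) - 1)

end DiscreteHawkes

/-! Integrating out X_t, X_{t-1}, … one at a time, a Poisson variable with coefficient c contributes
exp(λ(e^c − 1)), and λ is affine in the past. The resulting coefficients obey the recursion of f_s,
whence E e^{zN_t} = exp(ν ∑_{s<t} (e^{f_s(z)} − 1)) (`IsHawkes.integral_cexp_count`).

Write a = ‖α‖₁ < 1. Near z = 0, f_s(z) tends to the small solution w of w = z + a(e^w − 1), analytic
by the inverse function theorem (`fInf_local`); implicit differentiation gives η'(0) and η''(0). If
∑ iα_i < ∞, the errors f_s − f_∞ are summable in s, with sum O(|f_∞(z)|), so the exponent above is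
tη(z) + o(1) when z → 0 (`tendsto_correction`).

The probability of N_t ≥ K, with K = tx an integer, is an exact integral over Re z = θ, |Im z| ≤ π
(`tail_eq_integral`). Take θ = I'(x), the saddle point, where xθ − η(θ) = I(x). On the scale
t^{-1/2} the integrand times θe^{tI(x)} converges to a Gaussian (`tendsto_saddleIntegrand`), and
positivity of the coefficients of the recursion gives a Gaussian majorant on the whole segment
(`norm_laplace_le`). Dominated convergence yields P(N_t ≥ K) ~ e^{-tI(x)} / (I'(x)√(2πtη''(0)))
(`IsHawkes.tendsto_tail`).

At the mean x₀ = ν/(1 − a), I and I' vanish and I'' = 1/η''(0), so I'(x) is linearised and tI(x) is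
Taylor expanded; the growth condition on y says exactly that the terms from order m on vanish.
Rounding to an integer level is harmless because I'(x₀) = 0. Part (a) is calculus, by partial
fractions of I''. -/

namespace DiscreteHawkes

/-! ### The limit f_∞: fixed-point equation, convergence, analyticity. -/

section LimitFunction

theorem norm_cexp_sub_cexp_le {δ : ℝ} {u v : ℂ} (hu : ‖u‖ ≤ δ) (hv : ‖v‖ ≤ δ) :
    ‖Complex.exp u - Complex.exp v‖ ≤ Real.exp δ * ‖u - v‖ := by
  refine (convex_closedBall (0 : ℂ) δ).norm_image_sub_le_of_norm_deriv_le (𝕜 := ℂ)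
    (fun x _ => Complex.differentiableAt_exp) (fun x hx => ?_) (by simpa using hv) (by simpa using hu)
  rw [Complex.deriv_exp, Complex.norm_exp]
  exact Real.exp_le_exp.2 ((Complex.re_le_norm x).trans (by simpa using hx))

theorem norm_cexp_sub_one_le {δ : ℝ} {u : ℂ} (hu : ‖u‖ ≤ δ) :
    ‖Complex.exp u - 1‖ ≤ Real.exp δ * ‖u‖ := by
  simpa using norm_cexp_sub_cexp_le hu (v := 0) (by simpa using (norm_nonneg u).trans hu)

/-- A bounded sequence dominated by its convolution with a kernel of mass less than one, up to a
vanishing error, vanishes at infinity. -/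
theorem tendsto_zero_of_le_convolution {k d e : ℕ → ℝ} {B : ℝ} (hk : ∀ i, 0 ≤ k i)
    (hks : Summable k) (hk1 : ∑' i, k i < 1) (hd : ∀ s, 0 ≤ d s) (hdB : ∀ s, d s ≤ B)
    (he : Tendsto e atTop (𝓝 0))
    (h : ∀ s, d s ≤ ∑ i ∈ Finset.Icc 1 s, k i * d (s - i) + e s) :
    Tendsto d atTop (𝓝 0) := by
  set q := ∑' i, k i with hq
  have hq0 : 0 ≤ q := tsum_nonneg hk
  have hB : 0 ≤ B := (hd 0).trans (hdB 0)
  -- An eventual bound L improves to qL, up to ε; iterating drives the limsup to 0.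
  have step : ∀ L : ℝ, 0 ≤ L → (∀ᶠ s in atTop, d s ≤ L) → ∀ ε > 0,
      ∀ᶠ s in atTop, d s ≤ q * L + ε := by
    intro L hL hdL ε hε
    -- Contribution of the excess of d over L. For fixed i it vanishes for large s, and k_i B
    -- dominates it, so its sum over i tends to 0.
    set g : ℕ → ℕ → ℝ := fun s i => k i * (if i ≤ s then max (d (s - i) - L) 0 else 0) with hg
    have hgb : ∀ s i, ‖g s i‖ ≤ k i * B := by
      intro s i
      rw [hg, norm_mul, Real.norm_of_nonneg (hk i)]
      refine mul_le_mul_of_nonneg_left ?_ (hk i)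
      split_ifs
      · rw [Real.norm_of_nonneg (le_max_right _ _)]
        exact max_le (by linarith [hdB (s - i)]) hB
      · simpa using hB
    have hlim : Tendsto (fun s => ∑' i, g s i) atTop (𝓝 (∑' _ : ℕ, (0 : ℝ))) := by
      refine tendsto_tsum_of_dominated_convergence (hks.mul_right B) (fun i => ?_)
        (Eventually.of_forall fun s i => hgb s i)
      refine tendsto_const_nhds.congr' ?_
      have hsi : Tendsto (fun s : ℕ => s - i) atTop atTop := tendsto_sub_atTop_nat i
      filter_upwards [hsi.eventually hdL] with s hs
      simp only [hg]
      rw [max_eq_right (by linarith)]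
      simp
    rw [tsum_zero] at hlim
    have hsum := hlim.add he
    rw [add_zero] at hsum
    filter_upwards [hsum.eventually (gt_mem_nhds hε)] with s hs
    refine (h s).trans ?_
    have hgs : Summable (g s) := Summable.of_norm_bounded (hks.mul_right B) (hgb s)
    have h1 : ∑ i ∈ Finset.Icc 1 s, k i * d (s - i) ≤ ∑ i ∈ Finset.Icc 1 s, (k i * L + g s i) := by
      refine Finset.sum_le_sum fun i hi => ?_
      simp only [hg, if_pos (Finset.mem_Icc.1 hi).2, ← mul_add]
      refine mul_le_mul_of_nonneg_left ?_ (hk i)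
      linarith [le_max_left (d (s - i) - L) 0]
    have h2 : ∑ i ∈ Finset.Icc 1 s, (k i * L + g s i) ≤ ∑' i, (k i * L + g s i) := by
      refine ((hks.mul_right L).add hgs).sum_le_tsum _ fun i _ => ?_
      refine add_nonneg (mul_nonneg (hk i) hL) (mul_nonneg (hk i) ?_)
      split_ifs
      exacts [le_max_right _ _, le_rfl]
    rw [(hks.mul_right L).tsum_add hgs, tsum_mul_right] at h2
    linarith
  rw [Metric.tendsto_atTop']
  intro ε hε
  have hit : ∀ n : ℕ, ∀ᶠ s in atTop, d s ≤ q ^ n * B + ε / 2 := by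
    intro n
    induction n with
    | zero => exact Eventually.of_forall fun s => by linarith [hdB s]
    | succ n ih =>
      -- The slack (1 − q)ε/2 keeps the additive term at ε/2, since q(ε/2) + (1 − q)(ε/2) = ε/2.
      have := step _ (by positivity) ih ((1 - q) * (ε / 2)) (mul_pos (by linarith) (by linarith))
      filter_upwards [this] with s hs
      refine hs.trans (le_of_eq ?_)
      ring
  have hpow : Tendsto (fun n : ℕ => q ^ n * B) atTop (𝓝 (0 * B)) :=
    (tendsto_pow_atTop_nhds_zero_of_lt_one hq0 hk1).mul_const B
  rw [zero_mul] at hpow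
  obtain ⟨n, hn⟩ := (hpow.eventually (gt_mem_nhds (half_pos hε))).exists
  obtain ⟨N, hN⟩ := eventually_atTop.1 (hit n)
  refine ⟨N, fun s hs => ?_⟩
  rw [Real.dist_eq, sub_zero, abs_of_nonneg (hd s)]
  linarith [hN s hs.le]

variable {α : ℕ → ℝ≥0}

theorem summable_coe_of_summable (hα : Summable α) : Summable fun i => (α i : ℝ) :=
  NNReal.summable_coe.2 hα

theorem l1Norm_nonneg (α : ℕ → ℝ≥0) : 0 ≤ l1Norm α := tsum_nonneg fun _ => NNReal.coe_nonneg _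

theorem sum_Icc_le_l1Norm (hα : Summable α) (s : ℕ) :
    ∑ i ∈ Finset.Icc 1 s, (α i : ℝ) ≤ l1Norm α :=
  (summable_coe_of_summable hα).sum_le_tsum _ fun _ _ => NNReal.coe_nonneg _

theorem tendsto_sum_Icc (hα0 : α 0 = 0) (hα : Summable α) :
    Tendsto (fun s => ∑ i ∈ Finset.Icc 1 s, (α i : ℝ)) atTop (𝓝 (l1Norm α)) := by
  have h := (tendsto_add_atTop_iff_nat 1).2
    (summable_coe_of_summable hα).hasSum.tendsto_sum_nat
  refine h.congr fun s => ?_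
  rw [Finset.range_eq_Ico, Finset.sum_eq_sum_Ico_succ_bot (Nat.succ_pos s), hα0]
  simp only [NNReal.coe_zero, zero_add]
  rfl

theorem l1Norm_sub_sum_Icc_eq (hα0 : α 0 = 0) (hα : Summable α) (s : ℕ) :
    l1Norm α - ∑ i ∈ Finset.Icc 1 s, (α i : ℝ) = ∑' i, if s < i then (α i : ℝ) else 0 := by
  have h0 : ∑ i ∈ Finset.Icc 1 s, (α i : ℝ) = ∑' i, if s < i then 0 else (α i : ℝ) := by
    rw [tsum_eq_sum (s := Finset.Icc 1 s)]
    · refine Finset.sum_congr rfl fun i hi => ?_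
      rw [if_neg (not_lt.2 (Finset.mem_Icc.1 hi).2)]
    · intro i hi
      rw [Finset.mem_Icc, not_and_or, not_le, not_le] at hi
      rcases hi with hi | hi
      · rw [Nat.lt_one_iff.1 hi, hα0]; simp
      · rw [if_pos hi]
  have hs := summable_coe_of_summable hα
  rw [h0, l1Norm, ← (Summable.tsum_sub hs _)]
  · refine tsum_congr fun i => ?_
    split_ifs <;> simp
  · refine Summable.of_nonneg_of_le (fun i => ?_) (fun i => ?_) hs <;> split_ifs <;> simp

/-- After exchanging sums, α_i is counted once for each s < min(i, T), hence at most i times. This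
is where the first moment of α enters. -/
theorem sum_tail_le (hα0 : α 0 = 0) (hα : Summable α)
    (hiα : Summable fun i : ℕ => (i : ℝ) * (α i : ℝ)) (T : ℕ) :
    ∑ s ∈ Finset.range T, (l1Norm α - ∑ i ∈ Finset.Icc 1 s, (α i : ℝ))
      ≤ ∑' i : ℕ, (i : ℝ) * (α i : ℝ) := by
  have hs := summable_coe_of_summable hα
  have hs' : ∀ s, Summable fun i => if s < i then (α i : ℝ) else 0 := fun s => by
    refine Summable.of_nonneg_of_le (fun i => ?_) (fun i => ?_) hs <;> split_ifs <;> simp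
  simp_rw [l1Norm_sub_sum_Icc_eq hα0 hα]
  rw [← Summable.tsum_finsetSum fun s _ => hs' s]
  refine Summable.tsum_le_tsum (fun i => ?_) (summable_sum fun s _ => hs' s) hiα
  rw [← Finset.sum_filter, Finset.sum_const, nsmul_eq_mul]
  refine mul_le_mul_of_nonneg_right ?_ (NNReal.coe_nonneg _)
  have : (Finset.range T).filter (fun s => s < i) ⊆ Finset.range i := fun s hs => by
    simpa using (Finset.mem_filter.1 hs).2
  exact_mod_cast (Finset.card_le_card this).trans (Finset.card_range i).le

/-- The radius D = ‖z‖/(1 − q) solves D = ‖z‖ + qD, so the recursion preserves the ball of radius D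
≤ δ, on which exp has Lipschitz constant e^δ. -/
theorem norm_f_le (hα : Summable α) {δ q : ℝ} (hq : l1Norm α * Real.exp δ ≤ q) (hq1 : q < 1)
    {z : ℂ} (hz : ‖z‖ ≤ (1 - q) * δ) (s : ℕ) : ‖f α z s‖ ≤ ‖z‖ / (1 - q) := by
  induction s using Nat.strong_induction_on with
  | _ s ih =>
    have h1q : 0 < 1 - q := by linarith
    have hD : ‖z‖ / (1 - q) ≤ δ := by rwa [div_le_iff₀ h1q, mul_comm]
    rw [f_eq]
    have h1 : ‖∑ i ∈ Finset.Icc 1 s, ((α i : ℝ) : ℂ) * (Complex.exp (f α z (s - i)) - 1)‖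
        ≤ ∑ i ∈ Finset.Icc 1 s, (α i : ℝ) * (Real.exp δ * (‖z‖ / (1 - q))) := by
      refine norm_sum_le_of_le _ fun i hi => ?_
      have hi' := Finset.mem_Icc.1 hi
      have hf := ih (s - i) (by omega)
      rw [norm_mul, Complex.norm_real, Real.norm_of_nonneg (NNReal.coe_nonneg _)]
      refine mul_le_mul_of_nonneg_left ?_ (NNReal.coe_nonneg _)
      exact (norm_cexp_sub_one_le (hf.trans hD)).trans
        (mul_le_mul_of_nonneg_left hf (Real.exp_pos _).le)
    rw [← Finset.sum_mul] at h1
    have h2 : (∑ i ∈ Finset.Icc 1 s, (α i : ℝ)) * (Real.exp δ * (‖z‖ / (1 - q)))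
        ≤ q * (‖z‖ / (1 - q)) := by
      rw [← mul_assoc]
      refine mul_le_mul_of_nonneg_right ?_ (by positivity)
      exact (mul_le_mul_of_nonneg_right (sum_Icc_le_l1Norm hα s) (Real.exp_pos _).le).trans hq
    calc _ ≤ ‖z‖ + q * (‖z‖ / (1 - q)) := (norm_add_le _ _).trans (by linarith)
      _ = ‖z‖ / (1 - q) := by field_simp; ring

/-- Subtract the fixed-point equation from the recursion: what is left over is the mass of α beyond
s, times e^w − 1. -/
theorem norm_f_sub_le (hα : Summable α) {δ q : ℝ} (hq : l1Norm α * Real.exp δ ≤ q) (hq1 : q < 1)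
    {z w : ℂ} (hz : ‖z‖ ≤ (1 - q) * δ) (hw : ‖w‖ ≤ δ)
    (hzw : w = z + (l1Norm α : ℂ) * (Complex.exp w - 1)) (s : ℕ) :
    ‖f α z s - w‖ ≤ ∑ i ∈ Finset.Icc 1 s, (α i * Real.exp δ) * ‖f α z (s - i) - w‖
      + (l1Norm α - ∑ i ∈ Finset.Icc 1 s, (α i : ℝ)) * (Real.exp δ * ‖w‖) := by
  have h1q : 0 < 1 - q := by linarith
  have hD : ‖z‖ / (1 - q) ≤ δ := by rwa [div_le_iff₀ h1q, mul_comm]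
  have key : f α z s - w
      = ∑ i ∈ Finset.Icc 1 s, ((α i : ℝ) : ℂ) * (Complex.exp (f α z (s - i)) - Complex.exp w)
        - ((l1Norm α - ∑ i ∈ Finset.Icc 1 s, (α i : ℝ) : ℝ) : ℂ) * (Complex.exp w - 1) := by
    have h1 : ∑ i ∈ Finset.Icc 1 s,
          ((α i : ℝ) : ℂ) * (Complex.exp (f α z (s - i)) - Complex.exp w)
        = ∑ i ∈ Finset.Icc 1 s, ((α i : ℝ) : ℂ) * (Complex.exp (f α z (s - i)) - 1)
          - (∑ i ∈ Finset.Icc 1 s, ((α i : ℝ) : ℂ)) * (Complex.exp w - 1) := by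
      rw [Finset.sum_mul, ← Finset.sum_sub_distrib]
      exact Finset.sum_congr rfl fun i _ => by ring
    rw [h1, f_eq]
    push_cast
    linear_combination (-1 : ℂ) * hzw
  rw [key]
  refine (norm_sub_le _ _).trans (add_le_add (norm_sum_le_of_le _ fun i _ => ?_) ?_)
  · rw [norm_mul, Complex.norm_real, Real.norm_of_nonneg (NNReal.coe_nonneg _), mul_assoc]
    exact mul_le_mul_of_nonneg_left
      (norm_cexp_sub_cexp_le ((norm_f_le hα hq hq1 hz _).trans hD) hw) (NNReal.coe_nonneg _)
  · rw [norm_mul, Complex.norm_real,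
      Real.norm_of_nonneg (sub_nonneg.2 (sum_Icc_le_l1Norm hα s))]
    exact mul_le_mul_of_nonneg_left (norm_cexp_sub_one_le hw)
      (sub_nonneg.2 (sum_Icc_le_l1Norm hα s))

theorem tendsto_f_of_fixedPoint (hα0 : α 0 = 0) (hα : Summable α) {δ q : ℝ}
    (hq : l1Norm α * Real.exp δ ≤ q) (hq1 : q < 1) {z w : ℂ} (hz : ‖z‖ ≤ (1 - q) * δ)
    (hw : ‖w‖ ≤ δ) (hzw : w = z + (l1Norm α : ℂ) * (Complex.exp w - 1)) :
    Tendsto (f α z) atTop (𝓝 w) := by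
  have h1q : 0 < 1 - q := by linarith
  have hD : ‖z‖ / (1 - q) ≤ δ := by rwa [div_le_iff₀ h1q, mul_comm]
  have hs := summable_coe_of_summable hα
  rw [tendsto_iff_norm_sub_tendsto_zero]
  refine tendsto_zero_of_le_convolution (B := δ + δ) (k := fun i => (α i : ℝ) * Real.exp δ)
    (fun i => by positivity) (hs.mul_right _) ?_ (fun s => norm_nonneg _) (fun s => ?_) ?_
    (norm_f_sub_le hα hq hq1 hz hw hzw)
  · rw [tsum_mul_right]
    exact hq.trans_lt hq1
  · exact (norm_sub_le _ _).trans (add_le_add ((norm_f_le hα hq hq1 hz _).trans hD) hw)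
  · have := ((tendsto_sum_Icc hα0 hα).const_sub (l1Norm α)).mul_const (Real.exp δ * ‖w‖)
    simpa using this

/-- Sum `norm_f_sub_le` over s: the convolution costs a factor q < 1 and is absorbed on the left,
the tails sum to at most ∑ iα_i. The bound is uniform in T and linear in ‖w‖, so it vanishes as w →
0. -/
theorem sum_norm_f_sub_le (hα0 : α 0 = 0) (hα : Summable α)
    (hiα : Summable fun i : ℕ => (i : ℝ) * (α i : ℝ)) {δ q : ℝ}
    (hq : l1Norm α * Real.exp δ ≤ q) (hq1 : q < 1) {z w : ℂ} (hz : ‖z‖ ≤ (1 - q) * δ)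
    (hw : ‖w‖ ≤ δ) (hzw : w = z + (l1Norm α : ℂ) * (Complex.exp w - 1)) (T : ℕ) :
    ∑ s ∈ Finset.range T, ‖f α z s - w‖
      ≤ (∑' i : ℕ, (i : ℝ) * (α i : ℝ)) * Real.exp δ / (1 - q) * ‖w‖ := by
  have h1q : 0 < 1 - q := by linarith
  set d : ℕ → ℝ := fun s => ‖f α z s - w‖ with hd
  have hconv : ∑ s ∈ Finset.range T, ∑ i ∈ Finset.Icc 1 s, (α i * Real.exp δ) * d (s - i)
      ≤ q * ∑ s ∈ Finset.range T, d s := by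
    have h1 : ∑ s ∈ Finset.range T, ∑ i ∈ Finset.Icc 1 s, (α i * Real.exp δ) * d (s - i)
        ≤ ∑ i ∈ Finset.Icc 1 T, ∑ s ∈ Finset.range T, (α i * Real.exp δ) * d s := by
      have h2 : ∀ s ∈ Finset.range T,
          ∑ i ∈ Finset.Icc 1 s, (α i * Real.exp δ) * d (s - i)
            = ∑ i ∈ Finset.Icc 1 T, if i ≤ s then (α i * Real.exp δ) * d (s - i) else 0 := by
        intro s hs
        rw [← Finset.sum_filter]
        refine Finset.sum_congr ?_ fun _ _ => rfl
        ext i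
        simp only [Finset.mem_Icc, Finset.mem_filter, Finset.mem_range] at *
        omega
      rw [Finset.sum_congr rfl h2, Finset.sum_comm]
      refine Finset.sum_le_sum fun i _ => ?_
      rw [← Finset.sum_filter]
      have hinj : Set.InjOn (fun s => s - i) ((Finset.range T).filter fun s => i ≤ s) := by
        intro s hs s' hs' hss
        simp only [Finset.coe_filter, Set.mem_ofPred_eq] at hs hs' hss
        omega
      rw [← Finset.sum_image (f := fun s => (α i * Real.exp δ) * d s) hinj]
      refine Finset.sum_le_sum_of_subset_of_nonneg ?_ fun s _ _ => by positivity
      intro s hs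
      simp only [Finset.mem_image, Finset.mem_filter, Finset.mem_range] at hs ⊢
      omega
    refine h1.trans ?_
    simp_rw [← Finset.mul_sum, ← Finset.sum_mul]
    refine mul_le_mul_of_nonneg_right ?_ (Finset.sum_nonneg fun s _ => norm_nonneg _)
    exact (mul_le_mul_of_nonneg_right (sum_Icc_le_l1Norm hα T) (Real.exp_pos _).le).trans hq
  have hall := Finset.sum_le_sum fun s (_ : s ∈ Finset.range T) =>
    norm_f_sub_le hα hq hq1 hz hw hzw s
  rw [Finset.sum_add_distrib, ← Finset.sum_mul] at hall
  have htail := mul_le_mul_of_nonneg_right (sum_tail_le hα0 hα hiα T)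
    (by positivity : 0 ≤ Real.exp δ * ‖w‖)
  have hfin : (1 - q) * ∑ s ∈ Finset.range T, d s
      ≤ (∑' i : ℕ, (i : ℝ) * (α i : ℝ)) * (Real.exp δ * ‖w‖) := by
    simp only [hd] at hconv ⊢
    linarith
  calc _ ≤ (∑' i : ℕ, (i : ℝ) * (α i : ℝ)) * (Real.exp δ * ‖w‖) / (1 - q) := by
        rwa [le_div_iff₀ h1q, mul_comm]
    _ = _ := by ring

theorem exists_radius (ha : l1Norm α < 1) :
    ∃ δ q : ℝ, 0 < δ ∧ l1Norm α * Real.exp δ ≤ q ∧ q < 1 := by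
  have hc : ContinuousAt (fun δ : ℝ => l1Norm α * Real.exp δ) 0 := by fun_prop
  have h1 : l1Norm α * Real.exp 0 < 1 := by simpa using ha
  have h2 : ∀ᶠ δ in 𝓝[>] (0 : ℝ), l1Norm α * Real.exp δ < 1 :=
    (hc.eventually (gt_mem_nhds h1)).filter_mono nhdsWithin_le_nhds
  obtain ⟨δ, hδ, hδ0⟩ := (h2.and self_mem_nhdsWithin).exists
  exact ⟨δ, _, hδ0, le_rfl, hδ⟩

/-- Near `0`, the limit `f_∞` exists, is analytic with derivative `1 / (1 - ‖α‖₁)`, and solves the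
fixed-point equation. -/
theorem fInf_local (hα0 : α 0 = 0) (hα : Summable α) (ha : l1Norm α < 1) :
    (∀ᶠ z : ℂ in 𝓝 0, Tendsto (fun s => f α z s) atTop (𝓝 (fInf α z)) ∧
      fInf α z = z + (l1Norm α : ℂ) * (Complex.exp (fInf α z) - 1)) ∧
    fInf α 0 = 0 ∧ AnalyticAt ℂ (fInf α) 0 := by
  obtain ⟨δ, q, hδ, hq, hq1⟩ := exists_radius ha
  set Φ : ℂ → ℂ := fun w => w - (l1Norm α : ℂ) * (Complex.exp w - 1) with hΦ
  have hne : (1 - (l1Norm α : ℂ)) ≠ 0 := by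
    rw [sub_ne_zero]; exact_mod_cast ha.ne'
  have hΦa : AnalyticAt ℂ Φ 0 := by fun_prop
  have hΦd : HasDerivAt Φ (1 - (l1Norm α : ℂ)) 0 := by
    have := (hasDerivAt_id' (0 : ℂ)).fun_sub
      (((Complex.hasDerivAt_exp 0).sub_const 1).const_mul (l1Norm α : ℂ))
    rwa [Complex.exp_zero, mul_one] at this
  have hΦd' : deriv Φ 0 ≠ 0 := by rwa [hΦd.deriv]
  have hΦ0 : Φ 0 = 0 := by simp [hΦ]
  -- The fixed-point equation reads Φ(w) = z, and Φ'(0) = 1 − a ≠ 0.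
  set W : ℂ → ℂ := hΦa.hasStrictDerivAt.localInverse Φ _ 0 hΦd' with hW
  have hWa : AnalyticAt ℂ W 0 := by
    have := hΦa.analyticAt_localInverse hΦd'
    rwa [hΦ0] at this
  have hW0 : W 0 = 0 := by
    have : W (Φ 0) = 0 := HasStrictFDerivAt.localInverse_apply_image ..
    rwa [hΦ0] at this
  have hWr : ∀ᶠ z in 𝓝 0, Φ (W z) = z := by
    have := hΦa.hasStrictDerivAt.eventually_right_inverse hΦd'
    rwa [hΦ0] at this
  have hz : ∀ᶠ z : ℂ in 𝓝 0, ‖z‖ ≤ (1 - q) * δ := by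
    filter_upwards [Metric.closedBall_mem_nhds (0 : ℂ) (mul_pos (sub_pos.2 hq1) hδ)] with z hz
    simpa using hz
  have hw : ∀ᶠ z : ℂ in 𝓝 0, ‖W z‖ ≤ δ := by
    have h := hWa.continuousAt.tendsto
    rw [hW0] at h
    filter_upwards [h.eventually (Metric.closedBall_mem_nhds (0 : ℂ) hδ)] with z hz
    simpa using hz
  have hfix : ∀ᶠ z in 𝓝 0, W z = z + (l1Norm α : ℂ) * (Complex.exp (W z) - 1) := by
    filter_upwards [hWr] with z hz
    nth_rw 2 [← hz]
    simp [hΦ]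
  have hlim : ∀ᶠ z in 𝓝 0, Tendsto (fun s => f α z s) atTop (𝓝 (W z)) := by
    filter_upwards [hz, hw, hfix] with z h1 h2 h3
    exact tendsto_f_of_fixedPoint hα0 hα hq hq1 h1 h2 h3
  have heq : ∀ᶠ z in 𝓝 0, W z = fInf α z := hlim.mono fun z h => h.limUnder_eq.symm
  refine ⟨?_, ?_, hWa.congr heq⟩
  · filter_upwards [hlim, hfix, heq] with z h1 h2 h3
    rw [← h3]
    exact ⟨h1, h2⟩
  · rw [← heq.self_of_nhds, hW0]

/-- Implicit differentiation of the fixed-point equation, which holds on a neighbourhood of each z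
near 0. -/
theorem deriv_fInf (hα0 : α 0 = 0) (hα : Summable α) (ha : l1Norm α < 1) :
    ∀ᶠ z : ℂ in 𝓝 0, HasDerivAt (fInf α)
      (1 / (1 - (l1Norm α : ℂ) * Complex.exp (fInf α z))) z := by
  obtain ⟨h1, h0, han⟩ := fInf_local hα0 hα ha
  have hne : ∀ᶠ z : ℂ in 𝓝 0, 1 - (l1Norm α : ℂ) * Complex.exp (fInf α z) ≠ 0 := by
    have hc : ContinuousAt (fun z => 1 - (l1Norm α : ℂ) * Complex.exp (fInf α z)) 0 := by
      have := han.continuousAt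
      fun_prop
    refine hc.eventually_ne ?_
    rw [h0, Complex.exp_zero, mul_one, sub_ne_zero]
    exact_mod_cast ha.ne'
  have hfix : ∀ᶠ z : ℂ in 𝓝 0, ∀ᶠ u in 𝓝 z,
      fInf α u = u + (l1Norm α : ℂ) * (Complex.exp (fInf α u) - 1) :=
    eventually_eventually_nhds.2 (h1.mono fun z h => h.2)
  filter_upwards [hne, hfix, han.eventually_analyticAt] with z hne hfix han
  have hd := han.differentiableAt.hasDerivAt
  have hd2 := (hasDerivAt_id' z).fun_add ((hd.cexp.sub_const 1).const_mul (l1Norm α : ℂ))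
  have heq := hd.unique (hd2.congr_of_eventuallyEq hfix)
  rw [show 1 / (1 - (l1Norm α : ℂ) * Complex.exp (fInf α z)) = deriv (fInf α) z by
    rw [div_eq_iff hne]; linear_combination -heq]
  exact hd

theorem eta_local (ν : ℝ≥0) (hα0 : α 0 = 0) (hα : Summable α) (ha : l1Norm α < 1) :
    AnalyticAt ℂ (eta ν α) 0 ∧
      deriv (eta ν α) 0 = (((ν : ℝ) / (1 - l1Norm α) : ℝ) : ℂ) ∧
      iteratedDeriv 2 (eta ν α) 0 = (((ν : ℝ) / (1 - l1Norm α) ^ 3 : ℝ) : ℂ) := by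
  obtain ⟨-, h0, han⟩ := fInf_local hα0 hα ha
  have hd := deriv_fInf hα0 hα ha
  have hne : (1 - (l1Norm α : ℂ)) ≠ 0 := by
    rw [sub_ne_zero]; exact_mod_cast ha.ne'
  have hda : ∀ᶠ z in 𝓝 0, deriv (eta ν α) z = ((ν : ℝ) : ℂ) *
      (Complex.exp (fInf α z) * (1 / (1 - (l1Norm α : ℂ) * Complex.exp (fInf α z)))) := by
    filter_upwards [hd] with z hz
    exact ((hz.cexp.sub_const 1).const_mul ((ν : ℝ) : ℂ)).deriv
  have hd0 := hd.self_of_nhds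
  refine ⟨?_, ?_, ?_⟩
  · unfold eta
    fun_prop
  · rw [hda.self_of_nhds, h0]
    push_cast
    simp
    rfl
  · rw [iteratedDeriv_succ, iteratedDeriv_one, Filter.EventuallyEq.deriv_eq hda]
    have hE := hd0.cexp
    have hden := (hE.const_mul (l1Norm α : ℂ)).const_sub 1
    have hquo := (hE.fun_div hden (by rw [h0]; simpa using hne)).const_mul ((ν : ℝ) : ℂ)
    have h2 := hquo.deriv
    simp only [mul_one_div] at h2 ⊢
    rw [h2, h0]
    push_cast
    simp only [Complex.exp_zero, mul_one, one_mul]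
    field_simp
    ring

end LimitFunction

/-! ### The exact Laplace transform of N_t. -/

section LaplaceTransform

theorem hasSum_poisson_cexp (r : ℝ≥0) (c : ℂ) :
    HasSum (fun n : ℕ => (Real.exp (-r) * r ^ n / n.factorial : ℝ) • Complex.exp (c * n))
      (Complex.exp ((r : ℝ) * (Complex.exp c - 1))) := by
  have h := (NormedSpace.expSeries_div_hasSum_exp (((r : ℝ) : ℂ) * Complex.exp c)).mul_left
    (Complex.exp (-(r : ℝ)))
  rw [← Complex.exp_eq_exp_ℂ, ← Complex.exp_add] at h
  rw [show ((r : ℝ) : ℂ) * (Complex.exp c - 1) = -(r : ℝ) + ((r : ℝ) : ℂ) * Complex.exp c by ring]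
  convert! h using 2 with n
  rw [Complex.real_smul, mul_pow, ← Complex.exp_nat_mul, mul_comm (n : ℂ) c]
  push_cast
  ring

theorem integrable_poisson_cexp (r : ℝ≥0) (c : ℂ) :
    Integrable (fun n : ℕ => Complex.exp (c * n)) (poissonMeasure r) := by
  rw [integrable_poissonMeasure_iff]
  have h := (hasSum_poisson_cexp r c).summable.norm
  refine h.congr fun n => ?_
  rw [norm_smul, Real.norm_of_nonneg (by positivity)]

theorem integral_poisson_cexp (r : ℝ≥0) (c : ℂ) :
    ∫ n : ℕ, Complex.exp (c * n) ∂(poissonMeasure r)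
      = Complex.exp ((r : ℝ) * (Complex.exp c - 1)) := by
  rw [integral_poissonMeasure]
  exact (hasSum_poisson_cexp r c).tsum_eq

/-- The trajectory that takes the given values at the times `1, …, t - 1` and vanishes at all
other times. -/
def extendPast {t : ℕ} (v : Finset.Ico 1 t → ℕ) (s : ℕ) : ℕ :=
  if h : s ∈ Finset.Ico 1 t then v ⟨s, h⟩ else 0

/-- The values `X₁, …, X_{t-1}`. -/
def pastVector {Ω : Type*} (X : ℕ → Ω → ℕ) (t : ℕ) (ω : Ω) : Finset.Ico 1 t → ℕ := fun s => X s ω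

/-- The conditional law of `Xₜ` given `X₁, …, X_{t-1}`. -/
noncomputable def poissonKernel (ν : ℝ≥0) (α : ℕ → ℝ≥0) (t : ℕ) :
    Kernel (Finset.Ico 1 t → ℕ) ℕ where
  toFun v := poissonMeasure (intensity ν α (extendPast v) t)
  measurable' := Measurable.of_discrete

instance (ν : ℝ≥0) (α : ℕ → ℝ≥0) (t : ℕ) : IsMarkovKernel (poissonKernel ν α t) :=
  ⟨fun _ => inferInstanceAs (IsProbabilityMeasure (poissonMeasure _))⟩

theorem intensity_extendPast {Ω : Type*} (ν : ℝ≥0) (α : ℕ → ℝ≥0) (X : ℕ → Ω → ℕ) (t : ℕ) (ω : Ω) :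
    intensity ν α (extendPast (pastVector X t ω)) t = intensity ν α (fun s => X s ω) t := by
  unfold intensity
  congr 1
  refine Finset.sum_congr rfl fun s hs => ?_
  have : t - s ∈ Finset.Ico 1 t := by
    rw [Finset.mem_Ico] at *
    omega
  rw [extendPast, dif_pos this, pastVector]

theorem measurable_pastVector_past {Ω : Type*} (X : ℕ → Ω → ℕ) (t : ℕ) :
    Measurable[past X t] (pastVector X t) := by
  refine @measurable_pi_lambda _ _ _ (past X t) _ _ fun s => ?_
  have : MeasurableSpace.comap (X s) ⊤ ≤ past X t := by
    exact le_iSup₂_of_le (f := fun s (_ : s ∈ Finset.Ico 1 t) => MeasurableSpace.comap (X s) ⊤)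
      s.1 s.2 le_rfl
  exact (comap_measurable (X s)).mono this le_rfl

theorem IsHawkes.past_le {Ω : Type*} [MeasurableSpace Ω] {P : Measure Ω} {ν : ℝ≥0}
    {α : ℕ → ℝ≥0} {X : ℕ → Ω → ℕ} (hX : IsHawkes P ν α X) (t : ℕ) : past X t ≤ ‹MeasurableSpace Ω› :=
  iSup₂_le fun s _ => (hX.measurable s).comap_le

variable {Ω : Type*} [MeasurableSpace Ω] {P : Measure Ω} [IsProbabilityMeasure P]
  {ν : ℝ≥0} {α : ℕ → ℝ≥0} {X : ℕ → Ω → ℕ}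

/-- The target is countable and discrete, so equality on singletons {(v, k)} suffices; there, the
conditional probability of {X_t = k} is integrated over {past = v} in two ways. -/
theorem IsHawkes.map_pastVector_prod (hX : IsHawkes P ν α X) {t : ℕ} (ht : 1 ≤ t) :
    P.map (fun ω => (pastVector X t ω, X t ω))
      = (P.map (pastVector X t)) ⊗ₘ poissonKernel ν α t := by
  have hm := hX.past_le t
  have hV := (measurable_pastVector_past X t).mono hm le_rfl
  have hV' := hX.measurable t
  have := Measure.isProbabilityMeasure_map (μ := P) hV.aemeasurable
  refine Measure.ext_of_singleton ?_
  rintro ⟨v, k⟩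
  have hS : MeasurableSet[past X t] (pastVector X t ⁻¹' {v}) :=
    measurable_pastVector_past X t (measurableSet_singleton v)
  have hk : MeasurableSet (X t ⁻¹' {k}) := hV' (measurableSet_singleton k)
  rw [← Set.singleton_prod_singleton, Measure.compProd_apply_prod (measurableSet_singleton v)
    (measurableSet_singleton k), Measure.map_apply (hV.prodMk hV')
    ((measurableSet_singleton v).prod (measurableSet_singleton k)), Measure.restrict_singleton,
    lintegral_smul_measure, lintegral_dirac, Measure.map_apply hV (measurableSet_singleton v),
    Set.mk_preimage_prod]
  rw [← ENNReal.toReal_eq_toReal_iff' (measure_ne_top _ _)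
    (by rw [smul_eq_mul]; exact ENNReal.mul_ne_top (measure_ne_top _ _) (measure_ne_top _ _))]
  rw [smul_eq_mul, ENNReal.toReal_mul]
  have h1 : ∫ ω in pastVector X t ⁻¹' {v}, (P⟦X t ⁻¹' {k} | past X t⟧) ω ∂P
      = P.real (pastVector X t ⁻¹' {v} ∩ X t ⁻¹' {k}) := by
    rw [setIntegral_condExp hm ((integrable_const (1 : ℝ)).indicator hk) hS,
      setIntegral_indicator hk]
    simp
  have h2 : ∫ ω in pastVector X t ⁻¹' {v}, (P⟦X t ⁻¹' {k} | past X t⟧) ω ∂P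
      = ∫ ω in pastVector X t ⁻¹' {v}, (poissonKernel ν α t v).real {k} ∂P := by
    refine setIntegral_congr_ae (hm _ hS) ?_
    filter_upwards [hX.condPoisson t ht k] with ω hω hωv
    rw [hω, ← intensity_extendPast, Set.mem_singleton_iff.1 hωv]
    rfl
  rw [h1, setIntegral_const, smul_eq_mul] at h2
  exact h2

/-- Integrating out `Xₜ` conditionally on the past. -/
theorem IsHawkes.integral_step (hX : IsHawkes P ν α X) {t : ℕ} (ht : 1 ≤ t) (c : ℕ → ℂ)
    (hint : ∀ c : ℕ → ℂ,
      Integrable (fun ω => Complex.exp (∑ r ∈ Finset.Ico 1 t, c r * X r ω)) P) :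
    Integrable (fun ω => Complex.exp (∑ r ∈ Finset.Ico 1 (t + 1), c r * X r ω)) P ∧
    ∫ ω, Complex.exp (∑ r ∈ Finset.Ico 1 (t + 1), c r * X r ω) ∂P
      = Complex.exp ((ν : ℝ) * (Complex.exp (c t) - 1)) *
        ∫ ω, Complex.exp (∑ r ∈ Finset.Ico 1 t,
          (c r + (α (t - r) : ℝ) * (Complex.exp (c t) - 1)) * X r ω) ∂P := by
  have hV := (measurable_pastVector_past X t).mono (hX.past_le t) le_rfl
  have hV' := hX.measurable t
  have := Measure.isProbabilityMeasure_map (μ := P) hV.aemeasurable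
  set G : (Finset.Ico 1 t → ℕ) × ℕ → ℂ := fun p =>
    Complex.exp (∑ r ∈ Finset.Ico 1 t, c r * extendPast p.1 r) * Complex.exp (c t * p.2) with hG
  have hext : ∀ (d : ℕ → ℂ) (ω : Ω), ∑ r ∈ Finset.Ico 1 t, d r * extendPast (pastVector X t ω) r
      = ∑ r ∈ Finset.Ico 1 t, d r * X r ω := by
    intro d ω
    refine Finset.sum_congr rfl fun r hr => ?_
    rw [extendPast, dif_pos hr, pastVector]
  have hGX : ∀ ω, Complex.exp (∑ r ∈ Finset.Ico 1 (t + 1), c r * X r ω)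
      = G (pastVector X t ω, X t ω) := by
    intro ω
    rw [Finset.sum_Ico_succ_top ht, Complex.exp_add, hG]
    simp only [hext]
  -- The intensity is affine in the past; the substitution r = t − s attaches α_{t−r} to X_r.
  have hlam : ∀ (v : Finset.Ico 1 t → ℕ) (b : ℂ),
      ((intensity ν α (extendPast v) t : ℝ) : ℂ) * b
        = (ν : ℝ) * b + ∑ r ∈ Finset.Ico 1 t, ((α (t - r) : ℝ) * b) * extendPast v r := by
    intro v b
    have hrefl : ∑ s ∈ Finset.Ico 1 t, (α s : ℝ) * (extendPast v (t - s) : ℝ)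
        = ∑ r ∈ Finset.Ico 1 t, (α (t - r) : ℝ) * (extendPast v r : ℝ) := by
      refine Finset.sum_nbij' (fun s => t - s) (fun s => t - s) ?_ ?_ ?_ ?_ ?_ <;> intro s hs
      all_goals simp only [Finset.mem_Ico] at *
      · omega
      · omega
      · omega
      · omega
      · rw [Nat.sub_sub_self hs.2.le]
    have hval : (intensity ν α (extendPast v) t : ℝ)
        = ν + ∑ r ∈ Finset.Ico 1 t, (α (t - r) : ℝ) * (extendPast v r : ℝ) := by
      rw [← hrefl, intensity]
      push_cast
      rfl
    rw [hval]
    push_cast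
    rw [add_mul, Finset.sum_mul]
    congr 1
    exact Finset.sum_congr rfl fun r _ => by ring
  have hGm : AEStronglyMeasurable G ((P.map (pastVector X t)) ⊗ₘ poissonKernel ν α t) :=
    (Measurable.of_discrete).aestronglyMeasurable
  have hinner : ∀ (d : ℕ → ℂ) (b : ℂ) (v : Finset.Ico 1 t → ℕ),
      Complex.exp (∑ r ∈ Finset.Ico 1 t, d r * extendPast v r) *
        ∫ k : ℕ, Complex.exp (b * k) ∂(poissonKernel ν α t v)
      = Complex.exp ((ν : ℝ) * (Complex.exp b - 1)) * Complex.exp (∑ r ∈ Finset.Ico 1 t,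
          (d r + (α (t - r) : ℝ) * (Complex.exp b - 1)) * extendPast v r) := by
    intro d b v
    have : ∫ k : ℕ, Complex.exp (b * k) ∂(poissonKernel ν α t v)
      = Complex.exp ((intensity ν α (extendPast v) t : ℝ) * (Complex.exp b - 1)) :=
      integral_poisson_cexp _ _
    rw [this, hlam, ← Complex.exp_add, ← Complex.exp_add]
    congr 1
    simp_rw [add_mul, Finset.sum_add_distrib]
    ring
  have hpi : ∀ v (b : ℂ), Integrable (fun k : ℕ => Complex.exp (b * k))
      (poissonKernel ν α t v) := fun v b => integrable_poisson_cexp _ b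
  have hGint : Integrable G ((P.map (pastVector X t)) ⊗ₘ poissonKernel ν α t) := by
    rw [Measure.integrable_compProd_iff hGm]
    refine ⟨Eventually.of_forall fun v => (hpi v _).const_mul
      (Complex.exp (∑ r ∈ Finset.Ico 1 t, c r * extendPast v r)), ?_⟩
    rw [integrable_map_measure (Measurable.of_discrete).aestronglyMeasurable hV.aemeasurable]
    -- The norm of `G` has the same form as `G`, with the real parts of the coefficients. So
    -- `hinner` computes its inner integral, and `hint` applies to the shifted coefficients.
    set c' : ℕ → ℂ := fun r => ((c r).re : ℂ) with hc'
    have hnorm : ∀ p, ((‖G p‖ : ℝ) : ℂ)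
        = Complex.exp (∑ r ∈ Finset.Ico 1 t, c' r * extendPast p.1 r) *
          Complex.exp (c' t * p.2) := by
      intro p
      rw [hG, norm_mul, Complex.norm_exp, Complex.norm_exp]
      push_cast
      simp [hc']
    have h1 : ∀ v, (∫ k, ‖G (v, k)‖ ∂(poissonKernel ν α t v) : ℝ)
        = (Complex.exp ((ν : ℝ) * (Complex.exp (c' t) - 1)) *
          Complex.exp (∑ r ∈ Finset.Ico 1 t,
          (c' r + (α (t - r) : ℝ) * (Complex.exp (c' t) - 1)) * extendPast v r)).re := by
      intro v
      rw [← hinner, ← integral_const_mul, ← Complex.ofReal_re (∫ k, ‖G (v, k)‖ ∂_),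
        ← integral_complex_ofReal]
      simp_rw [hnorm]
    have h2 := ((hint fun r => c' r + (α (t - r) : ℝ) * (Complex.exp (c' t) - 1)).const_mul
      (Complex.exp ((ν : ℝ) * (Complex.exp (c' t) - 1)))).re
    refine h2.congr (Eventually.of_forall fun ω => ?_)
    simp only [Function.comp, h1, hext]
    rfl
  have hmap := hX.map_pastVector_prod ht
  have hpair := hV.prodMk hV'
  simp_rw [hGX]
  rw [← hmap] at hGint hGm
  refine ⟨(integrable_map_measure hGm hpair.aemeasurable).1 hGint, ?_⟩
  rw [← integral_map hpair.aemeasurable hGm, hmap, Measure.integral_compProd (hmap ▸ hGint)]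
  have h3 : ∀ v, ∫ k, G (v, k) ∂(poissonKernel ν α t v)
      = Complex.exp ((ν : ℝ) * (Complex.exp (c t) - 1)) * Complex.exp (∑ r ∈ Finset.Ico 1 t,
          (c r + (α (t - r) : ℝ) * (Complex.exp (c t) - 1)) * extendPast v r) := by
    intro v
    rw [← hinner, ← integral_const_mul]
  simp_rw [h3]
  rw [integral_const_mul, integral_map hV.aemeasurable
    (Measurable.of_discrete).aestronglyMeasurable]
  simp_rw [hext]

theorem IsHawkes.integrable_cexp (hX : IsHawkes P ν α X) (t : ℕ) (c : ℕ → ℂ) :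
    Integrable (fun ω => Complex.exp (∑ r ∈ Finset.Ico 1 (t + 1), c r * X r ω)) P := by
  induction t generalizing c with
  | zero => simp
  | succ t ih => exact (hX.integral_step (Nat.succ_pos t) c ih).1

/-- The coefficients of `X₁, …, Xₙ` after the last `t - n` variables have been integrated out. -/
noncomputable def tailCoeff (α : ℕ → ℝ≥0) (z : ℂ) (t n r : ℕ) : ℂ :=
  z + ∑ j ∈ Finset.Ico (n + 1) (t + 1), ((α (j - r) : ℝ) : ℂ) * (Complex.exp (f α z (t - j)) - 1)

/-- The coefficient of the next variable to be integrated out is f_{t−n}: this identifies the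
backward elimination with the recursion. -/
theorem tailCoeff_self (α : ℕ → ℝ≥0) (z : ℂ) {t n : ℕ} (h : n ≤ t) :
    tailCoeff α z t n n = f α z (t - n) := by
  rw [tailCoeff, f_eq]
  congr 1
  refine Finset.sum_nbij' (fun j => j - n) (fun i => i + n) ?_ ?_ ?_ ?_ ?_
  · intro j hj
    simp only [Finset.mem_Ico, Finset.mem_Icc] at *
    omega
  · intro j hj
    simp only [Finset.mem_Ico, Finset.mem_Icc] at *
    omega
  · intro j hj
    simp only [Finset.mem_Ico] at *
    omega
  · intro j hj
    simp
  · intro j hj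
    simp only [Finset.mem_Ico] at hj
    rw [show t - n - (j - n) = t - j by omega]

theorem tailCoeff_pred (α : ℕ → ℝ≥0) (z : ℂ) {t n : ℕ} (h : n + 1 ≤ t) (r : ℕ) :
    tailCoeff α z t (n + 1) r
        + ((α (n + 1 - r) : ℝ) : ℂ) * (Complex.exp (f α z (t - (n + 1))) - 1)
      = tailCoeff α z t n r := by
  rw [tailCoeff, tailCoeff, Finset.sum_eq_sum_Ico_succ_bot (a := n + 1) (by omega)]
  ring

/-- Each elimination releases a factor exp(ν(e^{f_k(z)} − 1)) and adds one term to every remaining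
coefficient (`tailCoeff_pred`). -/
theorem IsHawkes.integral_cexp_eq_tail (hX : IsHawkes P ν α X) (z : ℂ) (t k : ℕ) (hk : k ≤ t) :
    ∫ ω, Complex.exp (z * count X t ω) ∂P
      = Complex.exp ((ν : ℝ) * ∑ s ∈ Finset.range k, (Complex.exp (f α z s) - 1)) *
        ∫ ω, Complex.exp (∑ r ∈ Finset.Ico 1 (t - k + 1), tailCoeff α z t (t - k) r * X r ω) ∂P := by
  induction k with
  | zero =>
    simp only [tailCoeff, Finset.range_zero, Finset.sum_empty, mul_zero, Complex.exp_zero, one_mul,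
      Nat.sub_zero, Finset.Ico_self, add_zero]
    simp only [count, Nat.cast_sum, Finset.mul_sum]
    rfl
  | succ k ih =>
    rw [ih (by omega)]
    obtain ⟨n, hn⟩ : ∃ n, t - k = n + 1 := ⟨t - k - 1, by omega⟩
    have hn' : t - (k + 1) = n := by omega
    have htn : t - (n + 1) = k := by omega
    rw [hn, hn', (hX.integral_step (Nat.succ_pos n) _ fun c => hX.integrable_cexp n c).2,
      tailCoeff_self α z (by omega), htn, ← mul_assoc, ← Complex.exp_add, Finset.sum_range_succ,
      mul_add]
    simp_rw [← htn, tailCoeff_pred α z (show n + 1 ≤ t by omega)]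

theorem IsHawkes.integrable_cexp_count (hX : IsHawkes P ν α X) (z : ℂ) (t : ℕ) :
    Integrable (fun ω => Complex.exp (z * count X t ω)) P := by
  have h := hX.integrable_cexp t fun _ => z
  simp only [count, Nat.cast_sum, Finset.mul_sum]
  exact h

/-- The Laplace transform of `Nₜ`. -/
noncomputable def laplace (ν : ℝ≥0) (α : ℕ → ℝ≥0) (t : ℕ) (z : ℂ) : ℂ :=
  Complex.exp ((ν : ℝ) * ∑ s ∈ Finset.range t, (Complex.exp (f α z s) - 1))

theorem IsHawkes.integral_cexp_count (hX : IsHawkes P ν α X) (z : ℂ) (t : ℕ) :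
    ∫ ω, Complex.exp (z * count X t ω) ∂P = laplace ν α t z := by
  rw [hX.integral_cexp_eq_tail z t t le_rfl]
  simp [laplace]

end LaplaceTransform

/-! ### Decay along vertical lines and the inversion formula. -/

section Inversion

theorem f_ofReal_im (α : ℕ → ℝ≥0) (θ : ℝ) (s : ℕ) : (f α (θ : ℂ) s).im = 0 := by
  induction s using Nat.strong_induction_on with
  | _ s ih =>
    rw [f_eq, Complex.add_im, Complex.ofReal_im, zero_add, Complex.im_sum]
    refine Finset.sum_eq_zero fun i hi => ?_
    have hi' := Finset.mem_Icc.1 hi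
    rw [Complex.im_ofReal_mul, Complex.sub_im, Complex.exp_im, ih (s - i) (by omega)]
    simp

theorem f_ofReal (α : ℕ → ℝ≥0) (θ : ℝ) (s : ℕ) :
    f α (θ : ℂ) s = ((f α (θ : ℂ) s).re : ℂ) :=
  Complex.ext rfl (f_ofReal_im α θ s)

/-- Isolates exponentials with nonnegative coefficients, whose moduli are then bounded by their
values at Re z. -/
theorem f_eq_add_sum_cexp (α : ℕ → ℝ≥0) (z : ℂ) (s : ℕ) :
    f α z s = z + (-((∑ i ∈ Finset.Icc 1 s, (α i : ℝ) : ℝ) : ℂ)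
      + ∑ i ∈ Finset.Icc 1 s, ((α i : ℝ) : ℂ) * Complex.exp (f α z (s - i))) := by
  rw [f_eq]
  simp only [mul_sub, mul_one, Finset.sum_sub_distrib]
  push_cast
  ring

theorem norm_sum_cexp_f_le {α : ℕ → ℝ≥0} {z : ℂ} {s : ℕ}
    (h : ∀ j < s, (f α z j).re ≤ (f α (z.re : ℂ) j).re) :
    ‖∑ i ∈ Finset.Icc 1 s, ((α i : ℝ) : ℂ) * Complex.exp (f α z (s - i))‖
      ≤ ∑ i ∈ Finset.Icc 1 s, (α i : ℝ) * Real.exp (f α (z.re : ℂ) (s - i)).re := by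
  refine norm_sum_le_of_le _ fun i hi => ?_
  have hi' := Finset.mem_Icc.1 hi
  rw [norm_mul, Complex.norm_real, Real.norm_of_nonneg (NNReal.coe_nonneg _), Complex.norm_exp]
  exact mul_le_mul_of_nonneg_left (Real.exp_le_exp.2 (h _ (by omega))) (NNReal.coe_nonneg _)

theorem re_f_ofReal_eq (α : ℕ → ℝ≥0) (θ : ℝ) (s : ℕ) :
    (f α (θ : ℂ) s).re = θ + (-(∑ i ∈ Finset.Icc 1 s, (α i : ℝ))
      + ∑ i ∈ Finset.Icc 1 s, (α i : ℝ) * Real.exp (f α (θ : ℂ) (s - i)).re) := by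
  conv_lhs => rw [f_eq_add_sum_cexp]
  rw [Complex.add_re, Complex.add_re, Complex.neg_re, Complex.ofReal_re, Complex.ofReal_re,
    Complex.re_sum]
  congr 2
  refine Finset.sum_congr rfl fun i _ => ?_
  rw [Complex.re_ofReal_mul, f_ofReal, ← Complex.ofReal_exp, Complex.ofReal_re, Complex.ofReal_re]

theorem re_f_le (α : ℕ → ℝ≥0) (z : ℂ) (s : ℕ) : (f α z s).re ≤ (f α (z.re : ℂ) s).re := by
  induction s using Nat.strong_induction_on with
  | _ s ih =>
    rw [re_f_ofReal_eq, f_eq_add_sum_cexp, Complex.add_re, Complex.add_re, Complex.neg_re,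
      Complex.ofReal_re]
    gcongr
    exact (Complex.re_le_norm _).trans (norm_sum_cexp_f_le ih)

/-- A cluster reduced to its root contributes to `exp (f_s)` the term `exp z`, up to a constant;
this bounds the decay of the exponential along vertical lines. -/
theorem re_cexp_f_gap {α : ℕ → ℝ≥0} (hα : Summable α) (z : ℂ) (s : ℕ) :
    Real.exp (-l1Norm α) * (Real.exp z.re * (1 - Real.cos z.im))
      ≤ (Complex.exp (f α (z.re : ℂ) s)).re - (Complex.exp (f α z s)).re := by
  set A := ∑ i ∈ Finset.Icc 1 s, (α i : ℝ) with hA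
  set w := ∑ i ∈ Finset.Icc 1 s, ((α i : ℝ) : ℂ) * Complex.exp (f α z (s - i)) with hw
  set W := ∑ i ∈ Finset.Icc 1 s, (α i : ℝ) * Real.exp (f α (z.re : ℂ) (s - i)).re with hW
  have hwW : ‖w‖ ≤ W := norm_sum_cexp_f_le fun j _ => re_f_le α z j
  have h1 : (Complex.exp (f α (z.re : ℂ) s)).re = Real.exp z.re * (Real.exp (-A) * Real.exp W) := by
    rw [f_ofReal, ← Complex.ofReal_exp, Complex.ofReal_re, re_f_ofReal_eq, Real.exp_add,
      Real.exp_add]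
  have h2 : Complex.exp (f α z s)
      = (Real.exp (-A) : ℂ) * (Complex.exp z + Complex.exp z * (Complex.exp w - 1)) := by
    rw [f_eq_add_sum_cexp, Complex.exp_add, Complex.exp_add, ← hA, ← hw, Complex.ofReal_exp]
    push_cast
    ring
  -- |e^w − 1| ≤ e^{|w|} − 1 termwise in the power series; only the root term e^z keeps its cosine.
  have h3 : (Complex.exp z * (Complex.exp w - 1)).re ≤ Real.exp z.re * (Real.exp W - 1) := by
    refine (Complex.re_le_norm _).trans ?_
    rw [norm_mul, Complex.norm_exp]
    refine mul_le_mul_of_nonneg_left ?_ (Real.exp_pos _).le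
    have h := Complex.norm_exp_sub_sum_le_exp_norm_sub_sum w 1
    simp only [Finset.sum_range_one, pow_zero, Nat.factorial_zero, Nat.cast_one, div_one] at h
    linarith [Real.exp_le_exp.2 hwW]
  rw [h1, h2, Complex.re_ofReal_mul, Complex.add_re, Complex.exp_re]
  have h4 : Real.exp (-l1Norm α) ≤ Real.exp (-A) :=
    Real.exp_le_exp.2 (neg_le_neg (sum_Icc_le_l1Norm hα s))
  have h5 : 0 ≤ Real.exp z.re * (1 - Real.cos z.im) :=
    mul_nonneg (Real.exp_pos _).le (by linarith [Real.cos_le_one z.im])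
  calc _ ≤ Real.exp (-A) * (Real.exp z.re * (1 - Real.cos z.im)) :=
        mul_le_mul_of_nonneg_right h4 h5
    _ ≤ Real.exp (-A) * (Real.exp z.re * (1 - Real.cos z.im)
          + (Real.exp z.re * (Real.exp W - 1) - (Complex.exp z * (Complex.exp w - 1)).re)) := by
        refine mul_le_mul_of_nonneg_left ?_ (Real.exp_pos _).le
        linarith
    _ = _ := by ring

/-- Sums `re_cexp_f_gap` over s < t. The constant comes from 1 − cos ξ ≥ 2ξ²/π² on |ξ| ≤ π, and Re z
≥ 0 allows dropping e^{Re z}. -/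
theorem norm_laplace_le {α : ℕ → ℝ≥0} (hα : Summable α) (ν : ℝ≥0) (t : ℕ) {z : ℂ}
    (hre : 0 ≤ z.re) (him : |z.im| ≤ Real.pi) :
    ‖laplace ν α t z‖ ≤ ‖laplace ν α t (z.re : ℂ)‖ *
      Real.exp (-(ν * Real.exp (-l1Norm α) * (2 / Real.pi ^ 2) * (t * z.im ^ 2))) := by
  rw [laplace, laplace, Complex.norm_exp, Complex.norm_exp, ← Real.exp_add, Real.exp_le_exp,
    Complex.re_ofReal_mul, Complex.re_ofReal_mul, Complex.re_sum, Complex.re_sum]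
  have h1 : ∀ s, Real.exp (-l1Norm α) * (2 / Real.pi ^ 2 * z.im ^ 2)
      ≤ (Complex.exp (f α (z.re : ℂ) s)).re - (Complex.exp (f α z s)).re := by
    intro s
    refine le_trans ?_ (re_cexp_f_gap hα z s)
    refine mul_le_mul_of_nonneg_left ?_ (Real.exp_pos _).le
    have h2 : 2 / Real.pi ^ 2 * z.im ^ 2 ≤ 1 - Real.cos z.im := by
      linarith [Real.cos_le_one_sub_mul_cos_sq him]
    refine h2.trans (le_mul_of_one_le_left ?_ (Real.one_le_exp hre))
    linarith [Real.cos_le_one z.im]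
  have h2 : (t : ℝ) * (Real.exp (-l1Norm α) * (2 / Real.pi ^ 2 * z.im ^ 2))
      ≤ ∑ s ∈ Finset.range t, (Complex.exp (f α (z.re : ℂ) s) - 1).re
        - ∑ s ∈ Finset.range t, (Complex.exp (f α z s) - 1).re := by
    rw [← Finset.sum_sub_distrib]
    calc _ = ∑ s ∈ Finset.range t, (Real.exp (-l1Norm α) * (2 / Real.pi ^ 2 * z.im ^ 2)) := by
          simp
      _ ≤ _ := Finset.sum_le_sum fun s _ => by simpa using h1 s
  have h3 := mul_le_mul_of_nonneg_left h2 (NNReal.coe_nonneg ν)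
  rw [mul_sub] at h3
  linarith

theorem integral_cexp_int (θ : ℝ) (k : ℤ) :
    ∫ ξ : ℝ in (-Real.pi)..Real.pi, Complex.exp (k * (θ + ξ * Complex.I))
      = if k = 0 then 2 * Real.pi else 0 := by
  split_ifs with hk
  · simp [hk]
    ring
  · have hc : (k : ℂ) * Complex.I ≠ 0 := by simp [hk]
    have h1 : ∀ ξ : ℝ, Complex.exp (k * (θ + ξ * Complex.I))
        = Complex.exp (k * θ) * Complex.exp (k * Complex.I * ξ) := fun ξ => by
      rw [← Complex.exp_add]; ring_nf
    simp_rw [h1]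
    rw [intervalIntegral.integral_const_mul, integral_exp_mul_complex hc]
    have h2 : Complex.exp (k * Complex.I * (Real.pi : ℝ))
        = Complex.exp (k * Complex.I * ((-Real.pi : ℝ) : ℂ)) := by
      rw [Complex.exp_eq_exp_iff_exists_int]
      refine ⟨k, ?_⟩
      push_cast
      ring
    rw [h2, sub_self, zero_div, mul_zero, Complex.ofReal_zero]

theorem norm_cexp_neg_lt_one {z : ℂ} (hz : 0 < z.re) : ‖Complex.exp (-z)‖ < 1 := by
  rw [Complex.norm_exp, Real.exp_lt_one_iff]
  simpa using hz

theorem one_sub_cexp_neg_ne_zero {z : ℂ} (hz : 0 < z.re) : 1 - Complex.exp (-z) ≠ 0 := by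
  intro h
  have h1 := norm_cexp_neg_lt_one hz
  rw [← sub_eq_zero.1 h, norm_one] at h1
  exact lt_irrefl _ h1

theorem one_sub_exp_neg_le_norm (z : ℂ) : 1 - Real.exp (-z.re) ≤ ‖1 - Complex.exp (-z)‖ := by
  have h := norm_sub_norm_le (1 : ℂ) (Complex.exp (-z))
  rwa [norm_one, Complex.norm_exp, Complex.neg_re] at h

/-- Expand 1/(1 − e^{-z}) in powers of e^{-z}, which converges since θ > 0; orthogonality keeps only
j = n − K, which is an index exactly when K ≤ n. -/
theorem integral_cexp_div_one_sub {θ : ℝ} (hθ : 0 < θ) (n K : ℕ) :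
    ∫ ξ : ℝ in (-Real.pi)..Real.pi, Complex.exp ((θ + ξ * Complex.I) * n)
        * (Complex.exp (-(K * (θ + ξ * Complex.I))) / (1 - Complex.exp (-(θ + ξ * Complex.I))))
      = if K ≤ n then 2 * Real.pi else 0 := by
  set F : ℕ → ℝ → ℂ := fun j ξ => Complex.exp (((n - K - j : ℤ) : ℂ) * (θ + ξ * Complex.I)) with hF
  have hre : ∀ ξ : ℝ, ((θ : ℂ) + ξ * Complex.I).re = θ := by intro ξ; simp
  have hsum := intervalIntegral.hasSum_integral_of_dominated_convergence (μ := volume)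
    (a := -Real.pi) (b := Real.pi) (F := F)
    (f := fun ξ => Complex.exp ((θ + ξ * Complex.I) * n)
        * (Complex.exp (-(K * (θ + ξ * Complex.I))) / (1 - Complex.exp (-(θ + ξ * Complex.I)))))
    (fun j _ => Real.exp ((n - K) * θ) * Real.exp (-θ) ^ j)
    (fun j => (by fun_prop : Continuous (F j)).aestronglyMeasurable)
    (fun j => Eventually.of_forall fun ξ _ => ?_)
    (Eventually.of_forall fun ξ _ => (summable_geometric_of_lt_one (Real.exp_pos _).le
      (Real.exp_lt_one_iff.2 (by linarith))).mul_left _)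
    intervalIntegrable_const
    (Eventually.of_forall fun ξ _ => ?_)
  · simp only [hF, integral_cexp_int] at hsum
    refine hsum.unique ?_
    split_ifs with h
    · rw [Complex.ofReal_mul, Complex.ofReal_ofNat]
      convert! hasSum_ite_eq (n - K) (2 * (Real.pi : ℂ)) using 2 with j
      by_cases hj : j = n - K
      · rw [if_pos hj, if_pos (by omega)]
        push_cast
        rfl
      · rw [if_neg hj, if_neg (by omega), Complex.ofReal_zero]
    · convert! hasSum_zero with j
      rw [if_neg (by omega), Complex.ofReal_zero]
  · rw [Complex.norm_exp, ← Real.exp_nat_mul, ← Real.exp_add, Real.exp_le_exp]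
    refine le_of_eq ?_
    rw [← Complex.ofReal_intCast, Complex.re_ofReal_mul, hre]
    push_cast
    ring
  · have hz : 0 < ((θ : ℂ) + ξ * Complex.I).re := by rwa [hre]
    have hg := (hasSum_geometric_of_norm_lt_one (norm_cexp_neg_lt_one hz)).mul_left
      (Complex.exp ((θ + ξ * Complex.I) * n) * Complex.exp (-(K * (θ + ξ * Complex.I))))
    rw [← div_eq_mul_inv, mul_div_assoc] at hg
    convert! hg using 2 with j
    rw [hF, ← Complex.exp_nat_mul, ← Complex.exp_add, ← Complex.exp_add]
    push_cast
    ring_nf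

/-- Inversion formula for the tail of an integer-valued random variable with finite exponential
moments. -/
theorem tail_eq_integral {Ω : Type*} [MeasurableSpace Ω] {P : Measure Ω} [IsProbabilityMeasure P]
    {N : Ω → ℕ} (hN : Measurable N) {θ : ℝ} (hθ : 0 < θ)
    (hint : Integrable (fun ω => Complex.exp ((θ : ℂ) * N ω)) P) (K : ℕ) :
    ∫ ξ : ℝ in (-Real.pi)..Real.pi,
        (∫ ω, Complex.exp ((θ + ξ * Complex.I) * N ω) ∂P)
        * (Complex.exp (-(K * (θ + ξ * Complex.I))) / (1 - Complex.exp (-(θ + ξ * Complex.I))))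
      = ((2 * Real.pi * P.real {ω | K ≤ N ω} : ℝ) : ℂ) := by
  set g : ℝ → ℂ := fun ξ =>
    Complex.exp (-(K * (θ + ξ * Complex.I))) / (1 - Complex.exp (-(θ + ξ * Complex.I))) with hg
  have hre : ∀ ξ : ℝ, ((θ : ℂ) + ξ * Complex.I).re = θ := by intro ξ; simp
  have hgc : Continuous g := by
    refine Continuous.div (by fun_prop) (by fun_prop) fun ξ => ?_
    exact one_sub_cexp_neg_ne_zero (by rwa [hre])
  have hθ1 : 0 < 1 - Real.exp (-θ) := sub_pos.2 (Real.exp_lt_one_iff.2 (by linarith))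
  have hgb : ∀ ξ, ‖g ξ‖ ≤ 1 / (1 - Real.exp (-θ)) := by
    intro ξ
    rw [hg, norm_div, Complex.norm_exp]
    refine div_le_div₀ zero_le_one ?_ hθ1 ?_
    · rw [Real.exp_le_one_iff, Complex.neg_re, ← Complex.ofReal_natCast, Complex.re_ofReal_mul, hre]
      have : 0 ≤ (K : ℝ) * θ := by positivity
      linarith
    · have := one_sub_exp_neg_le_norm (θ + ξ * Complex.I)
      rwa [hre] at this
  have hle : -Real.pi ≤ Real.pi := by linarith [Real.pi_pos]
  have hswap := integral_integral_swap (μ := volume.restrict (Set.Ioc (-Real.pi) Real.pi)) (ν := P)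
    (f := fun ξ ω => Complex.exp ((θ + ξ * Complex.I) * N ω) * g ξ) ?_
  · have h1 : ∀ ω, ∫ ξ in Set.Ioc (-Real.pi) Real.pi,
        Complex.exp ((θ + ξ * Complex.I) * N ω) * g ξ
        = ({ω | K ≤ N ω}.indicator (fun _ => (2 * Real.pi : ℂ))) ω := by
      intro ω
      rw [← intervalIntegral.integral_of_le hle]
      rw [hg, integral_cexp_div_one_sub hθ (N ω) K]
      by_cases h : K ≤ N ω
      · rw [if_pos h, Set.indicator_of_mem (by exact h)]
        push_cast
        rfl
      · rw [if_neg h, Set.indicator_of_notMem (by exact h), Complex.ofReal_zero]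
    simp_rw [h1] at hswap
    rw [intervalIntegral.integral_of_le hle]
    simp_rw [integral_mul_const] at hswap
    rw [hswap, integral_indicator (show MeasurableSet {ω | K ≤ N ω} from
      hN (measurableSet_Ici (a := K))), setIntegral_const]
    rw [Complex.real_smul]
    push_cast
    ring
  · have hdom : Integrable (fun p : ℝ × Ω =>
        ‖Complex.exp ((θ : ℂ) * N p.2)‖ * (1 / (1 - Real.exp (-θ))))
        ((volume.restrict (Set.Ioc (-Real.pi) Real.pi)).prod P) :=
      (hint.norm.mul_const _).comp_snd _
    refine hdom.mono' ?_ (Eventually.of_forall fun p => ?_)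
    · refine Measurable.aestronglyMeasurable ?_
      have : Measurable fun p : ℝ × Ω => ((N p.2 : ℕ) : ℂ) :=
        (Measurable.of_discrete (f := fun n : ℕ => (n : ℂ))).comp (hN.comp measurable_snd)
      have h2 := hgc.measurable.comp (measurable_fst : Measurable (Prod.fst : ℝ × Ω → ℝ))
      refine Measurable.mul (Complex.measurable_exp.comp (Measurable.mul ?_ this)) h2
      fun_prop
    · simp only [Function.uncurry]
      rw [norm_mul]
      refine mul_le_mul (le_of_eq ?_) (hgb _) (norm_nonneg _) (norm_nonneg _)
      rw [Complex.norm_exp, Complex.norm_exp]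
      congr 1
      simp

end Inversion

/-! ### Derivatives of the rate function. -/

section RateFunction

/-- The real formula for the rate function on `[0, ∞)`, with `a` in place of `‖α‖₁`. -/
noncomputable def rateReal (ν a x : ℝ) : ℝ := x * Real.log (x / (ν + x * a)) - x + x * a + ν

theorem rate_toReal_eventuallyEq (ν : ℝ≥0) (α : ℕ → ℝ≥0) {x : ℝ} (hx : 0 < x) :
    (fun u => (rate ν α u).toReal) =ᶠ[𝓝 x] rateReal ν (l1Norm α) := by
  filter_upwards [lt_mem_nhds hx] with u hu
  rw [rate, if_pos hu.le, EReal.toReal_coe, rateReal]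

theorem contDiffAt_rateReal {ν a x : ℝ} (hν : 0 < ν) (ha : 0 ≤ a) (hx : 0 < x)
    (n : WithTop ℕ∞) : ContDiffAt ℝ n (rateReal ν a) x := by
  have hden : 0 < ν + x * a := by positivity
  have hquo : ContDiffAt ℝ n (fun x => x / (ν + x * a)) x :=
    ContDiffAt.fun_div (by fun_prop) (by fun_prop) hden.ne'
  have hlog : ContDiffAt ℝ n (fun x => Real.log (x / (ν + x * a))) x :=
    hquo.log (div_pos hx hden).ne'
  unfold rateReal
  fun_prop

theorem hasDerivAt_rateReal {ν a x : ℝ} (hν : 0 < ν) (ha : 0 ≤ a) (hx : 0 < x) :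
    HasDerivAt (rateReal ν a)
      (Real.log (x / (ν + x * a)) - a * (x / (ν + x * a) - 1)) x := by
  have hden : 0 < ν + x * a := by positivity
  have h1 : HasDerivAt (fun x => ν + x * a) a x := by
    simpa using ((hasDerivAt_id' x).mul_const a).const_add ν
  have h2 := ((hasDerivAt_id' x).fun_div h1 hden.ne').log (div_pos hx hden).ne'
  have h3 := ((((hasDerivAt_id' x).fun_mul h2).fun_sub (hasDerivAt_id' x)).fun_add
    ((hasDerivAt_id' x).mul_const a)).add_const ν
  convert! h3 using 1
  field_simp
  ring

theorem hasDerivAt_deriv_rateReal {ν a x : ℝ} (hν : 0 < ν) (ha : 0 ≤ a) (hx : 0 < x) :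
    HasDerivAt (fun x => Real.log (x / (ν + x * a)) - a * (x / (ν + x * a) - 1))
      (ν ^ 2 / (x * (ν + x * a) ^ 2)) x := by
  have hden : 0 < ν + x * a := by positivity
  have h1 : HasDerivAt (fun x => ν + x * a) a x := by
    simpa using ((hasDerivAt_id' x).mul_const a).const_add ν
  have h0 := (hasDerivAt_id' x).fun_div h1 hden.ne'
  have h2 := h0.log (div_pos hx hden).ne'
  convert! h2.fun_sub ((h0.sub_const 1).const_mul a) using 1
  field_simp
  ring

/-- I'' = 1/x − a/(ν + ax) − νa/(ν + ax)² in partial fractions, a form that is differentiated term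
by term. -/
theorem iteratedDeriv_rateReal {ν a : ℝ} (hν : 0 < ν) (ha : 0 ≤ a) (n : ℕ) :
    ∀ x : ℝ, 0 < x → iteratedDeriv (n + 2) (rateReal ν a) x =
      n.factorial * (-1) ^ n * ((x ^ (n + 1))⁻¹ - a ^ (n + 1) * ((ν + x * a) ^ (n + 1))⁻¹
        - (n + 1) * ν * a ^ (n + 1) * ((ν + x * a) ^ (n + 2))⁻¹) := by
  induction n with
  | zero =>
    intro x hx
    have hden : 0 < ν + x * a := by positivity
    have h1 : deriv (rateReal ν a)
        =ᶠ[𝓝 x] fun x => Real.log (x / (ν + x * a)) - a * (x / (ν + x * a) - 1) := by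
      filter_upwards [lt_mem_nhds hx] with u hu
      exact (hasDerivAt_rateReal hν ha hu).deriv
    rw [zero_add, iteratedDeriv_succ, iteratedDeriv_one, h1.deriv_eq,
      (hasDerivAt_deriv_rateReal hν ha hx).deriv]
    simp only [Nat.factorial_zero, Nat.cast_one, pow_zero, Nat.cast_zero]
    field_simp
    ring
  | succ n ih =>
    intro x hx
    have hden : 0 < ν + x * a := by positivity
    have h1 := (eventually_of_mem (lt_mem_nhds hx) ih)
    rw [show n + 1 + 2 = n + 2 + 1 by ring, iteratedDeriv_succ, Filter.EventuallyEq.deriv_eq h1]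
    have hd : HasDerivAt (fun x => ν + x * a) a x := by
      simpa using ((hasDerivAt_id' x).mul_const a).const_add ν
    have h2 := ((((hasDerivAt_id' x).fun_pow (n + 1)).fun_inv (by positivity)).fun_sub
      (((hd.fun_pow (n + 1)).fun_inv (by positivity)).const_mul (a ^ (n + 1)))).fun_sub
      (((hd.fun_pow (n + 2)).fun_inv (by positivity)).const_mul ((n + 1) * ν * a ^ (n + 1)))
    rw [(h2.const_mul ((n.factorial : ℝ) * (-1) ^ n)).deriv, Nat.factorial_succ]
    simp only [Nat.add_sub_cancel, show n + 2 - 1 = n + 1 by omega]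
    push_cast
    field_simp
    ring

theorem rate_derivatives {ν : ℝ≥0} (hν : 0 < ν) (α : ℕ → ℝ≥0) {x : ℝ} (hx : 0 < x) :
    ContDiffAt ℝ ((⊤ : ℕ∞) : WithTop ℕ∞) (fun u => (rate ν α u).toReal) x ∧
      ∀ i : ℕ, 2 ≤ i →
        iteratedDeriv i (fun u => (rate ν α u).toReal) x =
          ((i - 2).factorial : ℝ) * (-1) ^ (i - 2) * x ^ (1 - (i : ℤ)) *
            (((i : ℝ) - 1) * (l1Norm α * x / (ν + l1Norm α * x)) ^ i
              - (i : ℝ) * (l1Norm α * x / (ν + l1Norm α * x)) ^ (i - 1) + 1) := by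
  have ha := l1Norm_nonneg α
  have hν' : (0 : ℝ) < ν := hν
  have heq := rate_toReal_eventuallyEq ν α hx
  refine ⟨(contDiffAt_rateReal hν' ha hx _).congr_of_eventuallyEq heq, fun i hi => ?_⟩
  obtain ⟨n, rfl⟩ := Nat.exists_eq_add_of_le' hi
  rw [heq.iteratedDeriv_eq, iteratedDeriv_rateReal hν' ha n x hx]
  have hden : 0 < (ν : ℝ) + x * l1Norm α := by positivity
  -- With p = ax/(ν + ax), factor out x^{-(n+1)} and use ν/(ν + ax) = 1 − p to pass from partial
  -- fractions to the stated form.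
  have h1 : (1 - ((n + 2 : ℕ) : ℤ)) = -((n + 1 : ℕ) : ℤ) := by push_cast; ring
  rw [h1, zpow_neg, zpow_natCast, mul_comm (l1Norm α) x, Nat.add_sub_cancel,
    show n + 2 - 1 = n + 1 by omega]
  simp only [div_pow]
  push_cast
  field_simp
  ring

end RateFunction

/-! ### Local analysis at the saddle point θ = I'(x). -/

section SaddlePoint

/-- The correction between `log E[exp (z Nₜ)]` and `t η(z)`. -/
noncomputable def correction (ν : ℝ≥0) (α : ℕ → ℝ≥0) (t : ℕ) (z : ℂ) : ℂ :=
  (ν : ℝ) * ∑ s ∈ Finset.range t, (Complex.exp (f α z s) - Complex.exp (fInf α z))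

theorem laplace_eq (ν : ℝ≥0) (α : ℕ → ℝ≥0) (t : ℕ) (z : ℂ) :
    laplace ν α t z
      = Complex.exp (t * ((ν : ℝ) * (Complex.exp (fInf α z) - 1)) + correction ν α t z) := by
  rw [laplace, correction]
  congr 1
  simp only [Finset.sum_sub_distrib, Finset.sum_const, Finset.card_range, nsmul_eq_mul]
  ring

theorem tendsto_correction {α : ℕ → ℝ≥0} (ν : ℝ≥0) (hα0 : α 0 = 0) (hα : Summable α)
    (hiα : Summable fun i : ℕ => (i : ℝ) * (α i : ℝ)) (ha : l1Norm α < 1) {z : ℕ → ℂ}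
    (hz : Tendsto z atTop (𝓝 0)) :
    Tendsto (fun t => correction ν α t (z t)) atTop (𝓝 0) := by
  obtain ⟨δ, q, hδ, hq, hq1⟩ := exists_radius ha
  obtain ⟨hloc, h0, han⟩ := fInf_local hα0 hα ha
  have h1q : 0 < 1 - q := by linarith
  have hw : Tendsto (fun t => fInf α (z t)) atTop (𝓝 0) := by
    have := han.continuousAt.tendsto.comp hz
    rwa [h0] at this
  set C := (∑' i : ℕ, (i : ℝ) * (α i : ℝ)) * Real.exp δ / (1 - q) with hC
  refine squeeze_zero_norm' (a := fun t => ν * (Real.exp δ * (C * ‖fInf α (z t)‖))) ?_ ?_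
  · filter_upwards [hz.eventually (Metric.closedBall_mem_nhds 0 (mul_pos (sub_pos.2 hq1) hδ)),
      hw.eventually (Metric.closedBall_mem_nhds 0 hδ), hz.eventually hloc] with t h1 h2 h3
    rw [dist_zero_right] at h1 h2
    rw [correction, norm_mul, Complex.norm_real, Real.norm_of_nonneg (NNReal.coe_nonneg _)]
    refine mul_le_mul_of_nonneg_left ?_ (NNReal.coe_nonneg _)
    have hb : ∀ s ∈ Finset.range t, ‖Complex.exp (f α (z t) s) - Complex.exp (fInf α (z t))‖
        ≤ Real.exp δ * ‖f α (z t) s - fInf α (z t)‖ := by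
      intro s _
      refine norm_cexp_sub_cexp_le ((norm_f_le hα hq hq1 h1 s).trans ?_) h2
      rwa [div_le_iff₀ h1q, mul_comm]
    refine (norm_sum_le_of_le _ hb).trans ?_
    rw [← Finset.mul_sum]
    exact mul_le_mul_of_nonneg_left (sum_norm_f_sub_le hα0 hα hiα hq hq1 h1 h2 h3.2 t)
      (Real.exp_pos _).le
  · simpa using (((hw.norm.const_mul C).const_mul (Real.exp δ)).const_mul (ν : ℝ))

/-- The difference quotient `(exp v - 1) / v`, continuously extended to `v = 0`. -/
noncomputable def expSlope : ℂ → ℂ := dslope Complex.exp 0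

theorem mul_expSlope (v : ℂ) : v * expSlope v = Complex.exp v - 1 := by
  have := sub_smul_dslope Complex.exp 0 v
  simpa [expSlope] using this

theorem tendsto_expSlope : Tendsto expSlope (𝓝 0) (𝓝 1) := by
  have h := (continuousAt_dslope_same.2 (Complex.differentiableAt_exp (x := 0))).tendsto
  rwa [dslope_same, Complex.deriv_exp, Complex.exp_zero] at h

/-- The saddle point `I'(x)`. -/
noncomputable def saddle (ν a x : ℝ) : ℝ :=
  Real.log (x / (ν + x * a)) - a * (x / (ν + x * a) - 1)

section Mean

variable {ν a : ℝ}

theorem mean_identity (ha : a < 1) : ν + ν / (1 - a) * a = ν / (1 - a) := by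
  have : 1 - a ≠ 0 := by linarith
  field_simp
  ring

theorem mean_ratio (hν : 0 < ν) (ha : a < 1) :
    ν / (1 - a) / (ν + ν / (1 - a) * a) = 1 := by
  rw [mean_identity ha]
  exact div_self (div_pos hν (by linarith)).ne'

theorem saddle_mean (hν : 0 < ν) (ha : a < 1) : saddle ν a (ν / (1 - a)) = 0 := by
  rw [saddle, mean_ratio hν ha]
  simp

theorem rateReal_mean (hν : 0 < ν) (ha : a < 1) : rateReal ν a (ν / (1 - a)) = 0 := by
  rw [rateReal, mean_ratio hν ha]
  have := mean_identity (ν := ν) ha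
  simp only [Real.log_one]
  linarith

theorem hasDerivAt_saddle_mean (hν : 0 < ν) (ha0 : 0 ≤ a) (ha : a < 1) :
    HasDerivAt (saddle ν a) ((1 - a) ^ 3 / ν) (ν / (1 - a)) := by
  have h1 : 0 < 1 - a := by linarith
  have h := hasDerivAt_deriv_rateReal hν ha0 (div_pos hν h1)
  rw [mean_identity ha] at h
  convert! h using 1
  field_simp

/-- Linearisation of I' at the mean, where it vanishes with slope I''(x₀) = (1 − a)³/ν. -/
theorem tendsto_saddle_div (hν : 0 < ν) (ha0 : 0 ≤ a) (ha : a < 1) {x : ℕ → ℝ}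
    (hx : Tendsto x atTop (𝓝 (ν / (1 - a)))) (hne : ∀ᶠ t in atTop, x t ≠ ν / (1 - a)) :
    Tendsto (fun t => saddle ν a (x t) / (x t - ν / (1 - a))) atTop (𝓝 ((1 - a) ^ 3 / ν)) := by
  have h := (hasDerivAt_saddle_mean hν ha0 ha).tendsto_slope
  have hx' : Tendsto x atTop (𝓝[≠] (ν / (1 - a))) := tendsto_nhdsWithin_iff.2 ⟨hx, hne⟩
  refine (h.comp hx').congr fun t => ?_
  rw [Function.comp, slope_def_field, saddle_mean hν ha, sub_zero]

theorem tendsto_saddle (hν : 0 < ν) (ha0 : 0 ≤ a) (ha : a < 1) {x : ℕ → ℝ}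
    (hx : Tendsto x atTop (𝓝 (ν / (1 - a)))) :
    Tendsto (fun t => saddle ν a (x t)) atTop (𝓝 0) := by
  have h := (hasDerivAt_saddle_mean hν ha0 ha).continuousAt.tendsto.comp hx
  rwa [saddle_mean hν ha] at h

end Mean

/-- The integrand of the inversion formula, rescaled to the window of size `t ^ (-1/2)` around
the saddle point and normalised. -/
noncomputable def saddleIntegrand (ν : ℝ≥0) (α : ℕ → ℝ≥0) (t K : ℕ) (θ I : ℝ) (ξ : ℝ) : ℂ :=
  (laplace ν α t (θ + ξ * Complex.I) * (Complex.exp (-(K * (θ + ξ * Complex.I)))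
    / (1 - Complex.exp (-(θ + ξ * Complex.I))))) * ((θ * Real.exp I : ℝ) : ℂ)

/-- With w the logarithm, this is the saddle equation νe^w/(1 − ae^w) = x cleared of its
denominator. -/
theorem exp_log_ratio {ν a x : ℝ} (hν : 0 < ν) (ha : 0 ≤ a) (hx : 0 < x) :
    (ν + x * a) * Real.exp (Real.log (x / (ν + x * a))) = x := by
  have hden : 0 < ν + x * a := by positivity
  rw [Real.exp_log (div_pos hx hden)]
  field_simp

theorem saddle_fixedPoint {ν a x : ℝ} (hν : 0 < ν) (ha : 0 ≤ a) (hx : 0 < x) :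
    ((Real.log (x / (ν + x * a)) : ℝ) : ℂ)
      = (saddle ν a x : ℂ) + (a : ℂ) * (Complex.exp (Real.log (x / (ν + x * a)) : ℝ) - 1) := by
  have hden : 0 < ν + x * a := by positivity
  rw [← Complex.ofReal_exp, Real.exp_log (div_pos hx hden), saddle]
  push_cast
  ring

/-- The exponent of the integrand at `θ + h`, where `v` is the increment of `f_∞`. -/
theorem exponent_identity {ν a x t w θ I v h : ℂ}
    (hw : (ν + x * a) * Complex.exp w = x) (hθ : w = θ + a * (Complex.exp w - 1))
    (hv : w + v = θ + h + a * (Complex.exp (w + v) - 1)) (hI : I = x * w - x + x * a + ν) :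
    t * (ν * (Complex.exp (w + v) - 1)) - t * x * (θ + h) + t * I
      = t * (x * (Complex.exp v - 1 - v)) := by
  rw [Complex.exp_add] at *
  set E := Complex.exp w
  set F := Complex.exp v
  have h1 : ν * E = x - x * a * E := by linear_combination hw
  -- Both θ and h are explicit in w and v; once they are eliminated, the claim is a multiple of
  -- `hw`.
  have e1 : θ = w - a * (E - 1) := by linear_combination -hθ
  have e2 : h = w + v - θ - a * (E * F - 1) := by linear_combination -hv
  rw [hI, e2, e1]
  linear_combination t * F * hw

/-- 1 − e^{-z} ~ z = θ(1 + is/(rθ)), and rθ → ∞: the pole at 0 lies far from the saddle on the scale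
1/r, so the factor is asymptotically constant. -/
theorem tendsto_pole {θ r : ℕ → ℝ} (s : ℝ)
    (hr : Tendsto (fun t => r t * θ t) atTop atTop)
    (hz : Tendsto (fun t => (θ t : ℂ) + (s / r t : ℝ) * Complex.I) atTop (𝓝 0)) :
    Tendsto (fun t => (θ t : ℂ) / (1 - Complex.exp (-((θ t : ℂ) + (s / r t : ℝ) * Complex.I))))
      atTop (𝓝 1) := by
  have h1 : Tendsto (fun t => expSlope (-((θ t : ℂ) + (s / r t : ℝ) * Complex.I))) atTop (𝓝 1) :=
    tendsto_expSlope.comp (by simpa using hz.neg)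
  have h2 : Tendsto (fun t => (1 : ℂ) + ((s * (r t * θ t)⁻¹ : ℝ) : ℂ) * Complex.I)
      atTop (𝓝 1) := by
    have h3 : Tendsto (fun t => s * (r t * θ t)⁻¹) atTop (𝓝 0) := by
      simpa using (tendsto_inv_atTop_zero.comp hr).const_mul s
    have h4 := ((Complex.continuous_ofReal.tendsto 0).comp h3).mul_const Complex.I
    simpa using h4.const_add 1
  have h5 := ((h2.mul h1).inv₀ (by simp))
  rw [mul_one, inv_one] at h5
  refine h5.congr' ?_
  filter_upwards [hr.eventually_gt_atTop 0] with t ht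
  have hθ0 : (θ t : ℂ) ≠ 0 := by
    intro h
    rw [Complex.ofReal_eq_zero.1 h, mul_zero] at ht
    exact lt_irrefl _ ht
  have hr0 : (r t : ℂ) ≠ 0 := by
    intro h
    rw [Complex.ofReal_eq_zero.1 h, zero_mul] at ht
    exact lt_irrefl _ ht
  have hm := mul_expSlope (-((θ t : ℂ) + (s / r t : ℝ) * Complex.I))
  rw [show 1 - Complex.exp (-((θ t : ℂ) + (s / r t : ℝ) * Complex.I))
    = θ t * ((1 + ((s * (r t * θ t)⁻¹ : ℝ) : ℂ) * Complex.I) *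
      expSlope (-((θ t : ℂ) + (s / r t : ℝ) * Complex.I))) by
    rw [← neg_sub, ← hm]
    push_cast
    field_simp]
  rw [← div_div, div_self hθ0, one_div]

/-- The cubic remainder is at most (r|v|)²|v|e^{|v|}, with r|v| bounded and v → 0. -/
theorem tendsto_mul_cexp_sub {v : ℕ → ℂ} {r : ℕ → ℝ} {b : ℂ} (hv : Tendsto v atTop (𝓝 0))
    (hb : Tendsto (fun t => (r t : ℂ) * v t) atTop (𝓝 b)) :
    Tendsto (fun t => (r t : ℂ) ^ 2 * (Complex.exp (v t) - 1 - v t)) atTop (𝓝 (b ^ 2 / 2)) := by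
  have h1 : Tendsto (fun t => ((r t : ℂ) * v t) ^ 2 / 2) atTop (𝓝 (b ^ 2 / 2)) :=
    (hb.pow 2).div_const 2
  have h2 : Tendsto (fun t => (r t : ℂ) ^ 2 *
      (Complex.exp (v t) - ∑ m ∈ Finset.range 3, v t ^ m / m.factorial)) atTop (𝓝 0) := by
    refine squeeze_zero_norm
      (a := fun t => ‖(r t : ℂ) * v t‖ ^ 2 * (‖v t‖ * Real.exp ‖v t‖)) (fun t => ?_) ?_
    · rw [norm_mul, norm_pow]
      calc _ ≤ ‖(r t : ℂ)‖ ^ 2 * (‖v t‖ ^ 3 * Real.exp ‖v t‖) :=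
            mul_le_mul_of_nonneg_left (Complex.norm_exp_sub_sum_le_norm_mul_exp _ 3) (by positivity)
        _ = _ := by rw [norm_mul]; ring
    · have hn : Tendsto (fun t => ‖v t‖) atTop (𝓝 0) := by simpa using hv.norm
      have := (hb.norm.pow 2).mul (hn.mul ((Real.continuous_exp.tendsto 0).comp hn))
      simpa using this
  have h3 := h1.add h2
  rw [add_zero] at h3
  refine h3.congr fun t => ?_
  simp [Finset.sum_range_succ]
  ring

end SaddlePoint

/-! ### Sharp tail asymptotics by dominated convergence. -/

section TailAsymptotics

/-- The exponent is tx(e^v − 1 − v) plus a vanishing correction, and √t·v → is/(1 − a); its limit is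
x₀(is)²/(2(1 − a)²) = −νs²/(2(1 − a)³). -/
theorem tendsto_saddleIntegrand {ν : ℝ≥0} {α : ℕ → ℝ≥0} (hν : 0 < ν) (hα0 : α 0 = 0)
    (hα : Summable α) (hiα : Summable fun i : ℕ => (i : ℝ) * (α i : ℝ)) (ha : l1Norm α < 1)
    {K : ℕ → ℕ} {x : ℕ → ℝ} (hK : ∀ᶠ t in atTop, (K t : ℝ) = t * x t)
    (hx : Tendsto x atTop (𝓝 (ν / (1 - l1Norm α))))
    (hr : Tendsto (fun t : ℕ => √t * saddle ν (l1Norm α) (x t)) atTop atTop) (s : ℝ) :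
    Tendsto (fun t : ℕ => saddleIntegrand ν α t (K t) (saddle ν (l1Norm α) (x t))
      (t * rateReal ν (l1Norm α) (x t)) (s / √t)) atTop
      (𝓝 ((Real.exp (-(ν / (1 - l1Norm α) ^ 3 / 2) * s ^ 2) : ℝ) : ℂ)) := by
  set a := l1Norm α with hadef
  have ha0 : 0 ≤ a := l1Norm_nonneg α
  have hν' : (0 : ℝ) < ν := hν
  have h1a : 0 < 1 - a := by linarith
  set x₀ : ℝ := ν / (1 - a) with hx₀
  have hx₀pos : 0 < x₀ := div_pos hν' h1a
  set θ : ℕ → ℝ := fun t => saddle ν a (x t) with hθ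
  set w : ℕ → ℝ := fun t => Real.log (x t / (ν + x t * a)) with hw
  have hxpos : ∀ᶠ t in atTop, 0 < x t := hx.eventually (lt_mem_nhds hx₀pos)
  have hθ0 : Tendsto θ atTop (𝓝 0) := tendsto_saddle hν' ha0 ha hx
  have hw0 : Tendsto w atTop (𝓝 0) := by
    have hq : Tendsto (fun t => x t / (ν + x t * a)) atTop (𝓝 (x₀ / (ν + x₀ * a))) :=
      hx.div ((hx.mul_const a).const_add _) (by positivity)
    have h := hq.log (by positivity)
    rwa [mean_ratio hν' ha, Real.log_one] at h
  have hrt : Tendsto (fun t : ℕ => √(t : ℝ)) atTop atTop :=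
    Real.tendsto_sqrt_atTop.comp tendsto_natCast_atTop_atTop
  have hθc : Tendsto (fun t => (θ t : ℂ)) atTop (𝓝 0) := by
    have := (Complex.continuous_ofReal.tendsto 0).comp hθ0
    simpa [Function.comp_def] using this
  have hwc : Tendsto (fun t => (w t : ℂ)) atTop (𝓝 0) := by
    have := (Complex.continuous_ofReal.tendsto 0).comp hw0
    simpa [Function.comp_def] using this
  set h : ℕ → ℂ := fun t => ((s / √(t : ℝ) : ℝ) : ℂ) * Complex.I with hh
  have hh0 : Tendsto h atTop (𝓝 0) := by
    have h1 : Tendsto (fun t : ℕ => s / √(t : ℝ)) atTop (𝓝 0) := hrt.const_div_atTop s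
    have h2 := ((Complex.continuous_ofReal.tendsto 0).comp h1).mul_const Complex.I
    simpa [hh] using h2
  have hz0 : Tendsto (fun t => (θ t : ℂ) + h t) atTop (𝓝 0) := by simpa using hθc.add hh0
  obtain ⟨hloc, hf0, han⟩ := fInf_local hα0 hα ha
  -- `w` plays the role of f_∞(θ), but only the fixed-point equations of `w` and `w + v` are used.
  set v : ℕ → ℂ := fun t => fInf α ((θ t : ℂ) + h t) - w t with hv
  have hv0 : Tendsto v atTop (𝓝 0) := by
    have h1 := han.continuousAt.tendsto.comp hz0
    rw [hf0] at h1
    simpa using h1.sub hwc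
  have hwfix : ∀ᶠ t in atTop, (w t : ℂ) = θ t + (a : ℂ) * (Complex.exp (w t) - 1) := by
    filter_upwards [hxpos] with t ht
    exact saddle_fixedPoint hν' ha0 ht
  have hzfix : ∀ᶠ t in atTop,
      w t + v t = θ t + h t + (a : ℂ) * (Complex.exp (w t + v t) - 1) := by
    filter_upwards [hz0.eventually hloc] with t ht
    rw [hv, add_sub_cancel]
    exact ht.2
  have hrv : Tendsto (fun t : ℕ => ((√(t : ℝ) : ℝ) : ℂ) * v t) atTop
      (𝓝 ((s : ℂ) * Complex.I / (1 - (a : ℂ)))) := by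
    have hden : Tendsto (fun t => 1 - (a : ℂ) * Complex.exp (w t) * expSlope (v t)) atTop
        (𝓝 (1 - (a : ℂ))) := by
      have h1 := ((Complex.continuous_exp.tendsto 0).comp hwc).const_mul (a : ℂ)
      have h2 := (h1.mul (tendsto_expSlope.comp hv0)).const_sub 1
      simpa using h2
    have hne : (1 - (a : ℂ)) ≠ 0 := by
      rw [sub_ne_zero]; exact_mod_cast ha.ne'
    have h3 := (tendsto_const_nhds (x := (s : ℂ) * Complex.I)).div hden hne
    refine h3.congr' ?_
    filter_upwards [hwfix, hzfix, hden.eventually_ne hne, eventually_gt_atTop 0]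
      with t h4 h5 h6 h7
    have hsq : ((√(t : ℝ) : ℝ) : ℂ) ≠ 0 := by
      rw [Complex.ofReal_ne_zero]
      have : (0 : ℝ) < t := by exact_mod_cast h7
      positivity
    simp only [Pi.div_apply]
    rw [div_eq_iff h6]
    -- Difference of the two fixed-point equations, with e^v − 1 written as v times `expSlope v`.
    have h8 : h t = v t * (1 - (a : ℂ) * Complex.exp (w t) * expSlope (v t)) := by
      rw [Complex.exp_add] at h5
      linear_combination h4 - h5 + (a : ℂ) * Complex.exp (w t) * mul_expSlope (v t)
    rw [mul_assoc, ← h8, hh]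
    push_cast
    field_simp
  have hmain : Tendsto (fun t : ℕ => (x t : ℂ) * (((√(t : ℝ) : ℝ) : ℂ) ^ 2 *
      (Complex.exp (v t) - 1 - v t)) + correction ν α t (θ t + h t)) atTop
      (𝓝 ((x₀ : ℂ) * (((s : ℂ) * Complex.I / (1 - (a : ℂ))) ^ 2 / 2) + 0)) :=
    (((Complex.continuous_ofReal.tendsto x₀).comp hx).mul (tendsto_mul_cexp_sub hv0 hrv)).add
      (tendsto_correction ν hα0 hα hiα ha hz0)
  have hlim := ((Complex.continuous_exp.tendsto _).comp hmain).mul (tendsto_pole s hr hz0)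
  have hval : Complex.exp ((x₀ : ℂ) * (((s : ℂ) * Complex.I / (1 - (a : ℂ))) ^ 2 / 2) + 0) * 1
      = ((Real.exp (-(ν / (1 - a) ^ 3 / 2) * s ^ 2) : ℝ) : ℂ) := by
    have hne : (1 - (a : ℂ)) ≠ 0 := by
      rw [sub_ne_zero]; exact_mod_cast ha.ne'
    rw [Complex.ofReal_exp, mul_one, add_zero, div_pow, mul_pow, Complex.I_sq, hx₀]
    congr 1
    push_cast
    field_simp
  rw [hval] at hlim
  refine hlim.congr' ?_
  filter_upwards [hwfix, hzfix, hxpos, hK] with t h1 h2 h3 h4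
  have hexp := exponent_identity (ν := ((ν : ℝ) : ℂ)) (a := (a : ℂ)) (x := (x t : ℂ)) (t := (t : ℂ))
    (I := ((rateReal ν a (x t) : ℝ) : ℂ)) (w := w t) (θ := θ t) (v := v t) (h := h t)
    (by rw [← Complex.ofReal_exp]; exact_mod_cast exp_log_ratio hν' ha0 h3) h1 h2
    (by rw [rateReal]; push_cast; rfl)
  have hsq : ((√(t : ℝ) : ℝ) : ℂ) ^ 2 = t := by
    rw [← Complex.ofReal_pow, Real.sq_sqrt (Nat.cast_nonneg t), Complex.ofReal_natCast]
  have hwv : fInf α ((θ t : ℂ) + h t) = w t + v t := by rw [hv, add_sub_cancel]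
  have hKc : (K t : ℂ) = t * x t := by exact_mod_cast h4
  simp only [Function.comp]
  rw [saddleIntegrand, laplace_eq, hwv, hsq, ← mul_assoc, mul_comm (x t : ℂ) (t : ℂ), mul_assoc,
    ← hexp, hKc]
  push_cast
  rw [show (t : ℂ) * (((ν : ℝ) : ℂ) * (Complex.exp (w t + v t) - 1)) - t * x t * (θ t + h t)
      + t * (rateReal ν a (x t) : ℝ) + correction ν α t (θ t + h t)
    = (t * (((ν : ℝ) : ℂ) * (Complex.exp (w t + v t) - 1)) + correction ν α t (θ t + h t))
      + -(t * x t * (θ t + h t)) + t * (rateReal ν a (x t) : ℝ) by ring, Complex.exp_add,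
    Complex.exp_add]
  simp only [hh, hθ]
  push_cast
  ring

/-- On the vertical line |e^{-Kz}| is constant and |1 − e^{-z}| is least at the real point, so the
decay of the Laplace transform carries over to the integrand. -/
theorem norm_saddleIntegrand_le {ν : ℝ≥0} {α : ℕ → ℝ≥0} (hα : Summable α) (t K : ℕ) {θ : ℝ}
    (hθ : 0 < θ) (I : ℝ) {ξ : ℝ} (hξ : |ξ| ≤ Real.pi) :
    ‖saddleIntegrand ν α t K θ I ξ‖ ≤ ‖saddleIntegrand ν α t K θ I 0‖ *
      Real.exp (-(ν * Real.exp (-l1Norm α) * (2 / Real.pi ^ 2) * (t * ξ ^ 2))) := by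
  have hre : ((θ : ℂ) + ξ * Complex.I).re = θ := by simp
  have him : ((θ : ℂ) + ξ * Complex.I).im = ξ := by simp
  have h1 := norm_laplace_le hα ν t (z := (θ : ℂ) + ξ * Complex.I) (by rw [hre]; exact hθ.le)
    (by rwa [him])
  rw [hre, him] at h1
  have h2 : ‖Complex.exp (-(K * ((θ : ℂ) + ξ * Complex.I)))‖ = ‖Complex.exp (-(K * (θ : ℂ)))‖ := by
    rw [Complex.norm_exp, Complex.norm_exp]
    simp
  have hθ1 : 0 < 1 - Real.exp (-θ) := sub_pos.2 (Real.exp_lt_one_iff.2 (by linarith))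
  have h3 : ‖1 - Complex.exp (-(θ : ℂ))‖ = 1 - Real.exp (-θ) := by
    rw [← Complex.ofReal_neg, ← Complex.ofReal_exp, ← Complex.ofReal_one, ← Complex.ofReal_sub,
      Complex.norm_real, Real.norm_of_nonneg hθ1.le]
  have h4 := one_sub_exp_neg_le_norm ((θ : ℂ) + ξ * Complex.I)
  rw [hre] at h4
  have h5 : ‖Complex.exp (-(K * ((θ : ℂ) + ξ * Complex.I)))
      / (1 - Complex.exp (-((θ : ℂ) + ξ * Complex.I)))‖
      ≤ ‖Complex.exp (-(K * (θ : ℂ))) / (1 - Complex.exp (-(θ : ℂ)))‖ := by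
    rw [norm_div, norm_div, h2, h3]
    exact div_le_div_of_nonneg_left (norm_nonneg _) hθ1 h4
  simp only [saddleIntegrand, norm_mul, Complex.ofReal_zero, zero_mul, add_zero]
  calc _ ≤ (‖laplace ν α t θ‖ * Real.exp (-(ν * Real.exp (-l1Norm α) * (2 / Real.pi ^ 2) *
          (t * ξ ^ 2)))) * ‖Complex.exp (-(K * (θ : ℂ))) / (1 - Complex.exp (-(θ : ℂ)))‖
          * ‖((θ * Real.exp I : ℝ) : ℂ)‖ := by gcongr
    _ = _ := by ring

theorem continuous_saddleIntegrand {ν : ℝ≥0} {α : ℕ → ℝ≥0} (t K : ℕ) {θ : ℝ} (hθ : 0 < θ) (I : ℝ) :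
    Continuous (saddleIntegrand ν α t K θ I) := by
  have hf : ∀ s, Continuous fun z => f α z s := by
    intro s
    induction s using Nat.strong_induction_on with
    | _ s ih =>
      simp_rw [f_eq α _ s]
      refine continuous_id.add (continuous_finsetSum _ fun i hi => ?_)
      have hi' := Finset.mem_Icc.1 hi
      have := ih (s - i) (by omega)
      fun_prop
  have hl : Continuous (laplace ν α t) := by
    unfold laplace
    fun_prop
  have hne : ∀ ξ : ℝ, 1 - Complex.exp (-((θ : ℂ) + ξ * Complex.I)) ≠ 0 := fun ξ =>
    one_sub_cexp_neg_ne_zero (by simpa using hθ)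
  unfold saddleIntegrand
  fun_prop (disch := exact hne _)

/-- Rescaling of the inversion formula around the saddle point. -/
theorem IsHawkes.integral_saddleIntegrand {Ω : Type*} [MeasurableSpace Ω] {P : Measure Ω}
    [IsProbabilityMeasure P] {ν : ℝ≥0} {α : ℕ → ℝ≥0} {X : ℕ → Ω → ℕ} (hX : IsHawkes P ν α X)
    (t K : ℕ) {θ : ℝ} (hθ : 0 < θ) (I : ℝ) :
    ∫ s : ℝ, (Set.Ioc (-Real.pi) Real.pi).indicator (saddleIntegrand ν α t K θ I) (s / √t)
      = ((2 * Real.pi * (P.real {ω | K ≤ count X t ω} * Real.exp I * (√t * θ)) : ℝ) : ℂ) := by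
  have hcount : Measurable (count X t) := by
    unfold count
    exact Finset.measurable_sum _ fun s _ => hX.measurable s
  have htail := tail_eq_integral hcount hθ (hX.integrable_cexp_count θ t) K
  simp_rw [hX.integral_cexp_count] at htail
  have hle : -Real.pi ≤ Real.pi := by linarith [Real.pi_pos]
  rw [Measure.integral_comp_div (fun s => (Set.Ioc (-Real.pi) Real.pi).indicator
    (saddleIntegrand ν α t K θ I) s), integral_indicator measurableSet_Ioc,
    ← intervalIntegral.integral_of_le hle]
  simp only [saddleIntegrand]
  rw [intervalIntegral.integral_mul_const, htail, abs_of_nonneg (Real.sqrt_nonneg _),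
    Complex.real_smul]
  push_cast
  ring

/-- Sharp asymptotics of the upper tail at an integer level `K t`, in the regime in which
`K t / t` tends to the mean while the deviation exceeds the scale `√t`. -/
theorem IsHawkes.tendsto_tail {Ω : Type*} [MeasurableSpace Ω] {P : Measure Ω}
    [IsProbabilityMeasure P] {ν : ℝ≥0} {α : ℕ → ℝ≥0} {X : ℕ → Ω → ℕ} (hX : IsHawkes P ν α X)
    (hν : 0 < ν) (hα0 : α 0 = 0) (hα : Summable α)
    (hiα : Summable fun i : ℕ => (i : ℝ) * (α i : ℝ)) (ha : l1Norm α < 1)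
    {K : ℕ → ℕ} {x : ℕ → ℝ} (hK : ∀ᶠ t in atTop, (K t : ℝ) = t * x t)
    (hx : Tendsto x atTop (𝓝 (ν / (1 - l1Norm α))))
    (hr : Tendsto (fun t : ℕ => √t * saddle ν (l1Norm α) (x t)) atTop atTop) :
    Tendsto (fun t : ℕ => P.real {ω | K t ≤ count X t ω} *
        Real.exp (t * rateReal ν (l1Norm α) (x t)) * (√t * saddle ν (l1Norm α) (x t))) atTop
      (𝓝 (√(Real.pi / (ν / (1 - l1Norm α) ^ 3 / 2)) / (2 * Real.pi))) := by
  set a := l1Norm α with hadef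
  have hν' : (0 : ℝ) < ν := hν
  have h1a : 0 < 1 - a := by linarith
  set c : ℝ := ν * Real.exp (-a) * (2 / Real.pi ^ 2) with hc
  have hcpos : 0 < c := by have := Real.pi_pos; positivity
  have hpt := tendsto_saddleIntegrand hν hα0 hα hiα ha hK hx hr
  have hθ : ∀ᶠ t : ℕ in atTop, 0 < saddle ν a (x t) := by
    filter_upwards [hr.eventually_gt_atTop 0] with t ht
    exact pos_of_mul_pos_right ht (Real.sqrt_nonneg _)
  have hrt : Tendsto (fun t : ℕ => √(t : ℝ)) atTop atTop :=
    Real.tendsto_sqrt_atTop.comp tendsto_natCast_atTop_atTop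
  have hdct : Tendsto (fun t : ℕ => ∫ s : ℝ, (Set.Ioc (-Real.pi) Real.pi).indicator
      (saddleIntegrand ν α t (K t) (saddle ν a (x t)) (t * rateReal ν a (x t))) (s / √t)) atTop
      (𝓝 (∫ s : ℝ, ((Real.exp (-(ν / (1 - a) ^ 3 / 2) * s ^ 2) : ℝ) : ℂ))) := by
    refine tendsto_integral_filter_of_dominated_convergence
      (fun s => 2 * Real.exp (-c * s ^ 2)) ?_ ?_ ((integrable_exp_neg_mul_sq hcpos).const_mul 2) ?_
    · filter_upwards [hθ] with t ht
      exact (((continuous_saddleIntegrand t (K t) ht _).measurable.indicator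
        measurableSet_Ioc).comp (measurable_id.div_const _)).aestronglyMeasurable
    -- The integrand at the saddle tends to 1, hence is eventually below 2: this is the constant of
    -- the majorant.
    · have h0 := (hpt 0).norm
      simp only [zero_div, ne_eq, OfNat.ofNat_ne_zero, not_false_eq_true, zero_pow, mul_zero,
        Real.exp_zero, Complex.ofReal_one, norm_one] at h0
      filter_upwards [hθ, h0.eventually (gt_mem_nhds one_lt_two), eventually_gt_atTop 0]
        with t h1 h2 h3
      refine Eventually.of_forall fun s => ?_
      have ht0 : (0 : ℝ) < t := by exact_mod_cast h3
      by_cases hs : s / √(t : ℝ) ∈ Set.Ioc (-Real.pi) Real.pi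
      · rw [Set.indicator_of_mem hs]
        refine (norm_saddleIntegrand_le hα t (K t) h1 _
          (abs_le.2 ⟨hs.1.le, hs.2⟩)).trans ?_
        rw [div_pow, Real.sq_sqrt ht0.le, mul_div_cancel₀ _ ht0.ne', neg_mul]
        exact mul_le_mul_of_nonneg_right h2.le (Real.exp_pos _).le
      · rw [Set.indicator_of_notMem hs, norm_zero]
        positivity
    · refine Eventually.of_forall fun s => ?_
      refine (hpt s).congr' ?_
      have h1 : Tendsto (fun t : ℕ => s / √(t : ℝ)) atTop (𝓝 0) := hrt.const_div_atTop s
      filter_upwards [h1.eventually (Ioo_mem_nhds (neg_lt_zero.2 Real.pi_pos) Real.pi_pos)]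
        with t ht
      rw [Set.indicator_of_mem (Set.Ioo_subset_Ioc_self ht)]
  rw [integral_complex_ofReal, integral_gaussian] at hdct
  have hre := (Complex.continuous_re.tendsto _).comp hdct
  rw [Complex.ofReal_re] at hre
  refine (hre.div_const (2 * Real.pi)).congr' ?_
  filter_upwards [hθ] with t h1
  rw [Function.comp, hX.integral_saddleIntegrand t (K t) h1, Complex.ofReal_re,
    mul_div_cancel_left₀]
  have := Real.pi_pos
  positivity

end TailAsymptotics

/-! ### From the sharp tail to moderate deviations. -/

section ModerateDeviations

/-- The limiting standard deviation of `Nₜ / √t`. -/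
noncomputable def stdDev (ν a : ℝ) : ℝ := √ν / (1 - a) ^ ((3 : ℝ) / 2)

theorem stdDev_pos {ν a : ℝ} (hν : 0 < ν) (ha : a < 1) : 0 < stdDev ν a :=
  div_pos (Real.sqrt_pos.2 hν) (Real.rpow_pos_of_pos (by linarith) _)

theorem stdDev_sq {ν a : ℝ} (hν : 0 < ν) (ha : a < 1) : stdDev ν a ^ 2 = ν / (1 - a) ^ 3 := by
  have h1a : 0 ≤ 1 - a := by linarith
  rw [stdDev, div_pow, Real.sq_sqrt hν.le, ← Real.rpow_natCast, ← Real.rpow_mul h1a]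
  norm_num

/-- Taylor expansion of the rate function around the mean, along a sequence in the moderate
deviation regime. -/
theorem tendsto_mul_rateReal_sub_taylor {ν a : ℝ} (hν : 0 < ν) (ha0 : 0 ≤ a) (ha : a < 1) {m : ℕ}
    (hm : 2 ≤ m) {u : ℕ → ℝ} (hu : Tendsto u atTop (𝓝 (ν / (1 - a))))
    (hum : Tendsto (fun t : ℕ => (t : ℝ) * (u t - ν / (1 - a)) ^ m) atTop (𝓝 0)) :
    Tendsto (fun t : ℕ => t * rateReal ν a (u t) - ∑ i ∈ Finset.Ico 2 m,
      iteratedDeriv i (rateReal ν a) (ν / (1 - a)) / (i.factorial : ℝ)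
        * (t * (u t - ν / (1 - a)) ^ i)) atTop (𝓝 0) := by
  set x₀ := ν / (1 - a) with hx₀
  have hx₀pos : 0 < x₀ := div_pos hν (by linarith)
  have hT := taylor_isLittleO (f := rateReal ν a) (n := m) (convex_Ioi (0 : ℝ)) hx₀pos
    fun x hx => (contDiffAt_rateReal hν ha0 hx m).contDiffWithinAt
  rw [nhdsWithin_eq_nhds.2 (Ioi_mem_nhds hx₀pos)] at hT
  have h1 := (isBigO_refl (fun t : ℕ => (t : ℝ)) atTop).mul_isLittleO (hT.comp_tendsto hu)
  have h2 := h1.trans_tendsto (by simpa using hum)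
  -- The Taylor polynomial has degree m but the sum stops at m − 1: the term of order m joins the
  -- error, where `hum` makes it vanish.
  have h3 := h2.add (hum.const_mul (iteratedDeriv m (rateReal ν a) x₀ / (m.factorial : ℝ)))
  rw [mul_zero, add_zero] at h3
  refine h3.congr fun t => ?_
  simp only [Function.comp, taylor_within_apply, smul_eq_mul]
  have h4 : ∀ k, iteratedDerivWithin k (rateReal ν a) (Set.Ioi 0) x₀
      = iteratedDeriv k (rateReal ν a) x₀ := fun k =>
    iteratedDerivWithin_of_isOpen isOpen_Ioi hx₀pos
  simp_rw [h4]
  -- Order m is split off at one end, orders 0 and 1 at the other; the latter vanish because I and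
  -- I' vanish at the mean.
  rw [Finset.sum_range_succ, Finset.range_eq_Ico,
    Finset.sum_eq_sum_Ico_succ_bot (by omega : 0 < m),
    Finset.sum_eq_sum_Ico_succ_bot (by omega : 0 + 1 < m), iteratedDeriv_zero,
    iteratedDeriv_one, rateReal_mean hν ha, (hasDerivAt_rateReal hν ha0 hx₀pos).deriv]
  have h5 : Real.log (x₀ / (ν + x₀ * a)) - a * (x₀ / (ν + x₀ * a) - 1) = 0 := saddle_mean hν ha
  rw [h5]
  have h6 : ∑ i ∈ Finset.Ico 2 m, iteratedDeriv i (rateReal ν a) x₀ / (i.factorial : ℝ)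
        * (t * (u t - x₀) ^ i)
      = t * ∑ i ∈ Finset.Ico (0 + 1 + 1) m, ((i.factorial : ℝ)⁻¹ * (u t - x₀) ^ i)
        * iteratedDeriv i (rateReal ν a) x₀ := by
    rw [Finset.mul_sum]
    exact Finset.sum_congr rfl fun i _ => by ring
  rw [h6]
  ring

/-- Rounding costs t(I(x) − I(u)) = o(t|x − u|), since I has strict derivative 0 at the mean, and
t|x − u| ≤ 1. -/
theorem tendsto_mul_rateReal_sub {ν a : ℝ} (hν : 0 < ν) (ha0 : 0 ≤ a) (ha : a < 1)
    {x u : ℕ → ℝ} (hx : Tendsto x atTop (𝓝 (ν / (1 - a)))) (hu : Tendsto u atTop (𝓝 (ν / (1 - a))))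
    (hxu : ∀ᶠ t : ℕ in atTop, |t * (x t - u t)| ≤ 1) :
    Tendsto (fun t : ℕ => t * rateReal ν a (x t) - t * rateReal ν a (u t)) atTop (𝓝 0) := by
  have hx₀pos : 0 < ν / (1 - a) := div_pos hν (by linarith)
  have hs : HasStrictDerivAt (rateReal ν a) 0 (ν / (1 - a)) := by
    have h := (contDiffAt_rateReal hν ha0 hx₀pos 1).hasStrictDerivAt (by simp)
    rw [(hasDerivAt_rateReal hν ha0 hx₀pos).deriv] at h
    rwa [show Real.log _ - a * _ = 0 from saddle_mean hν ha] at h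
  have h1 := hs.hasStrictFDerivAt.isLittleO.comp_tendsto (hx.prodMk_nhds hu)
  have h2 := (isBigO_refl (fun t : ℕ => (t : ℝ)) atTop).mul_isLittleO h1
  have h3 : (fun t : ℕ => (t : ℝ) * (x t - u t)) =O[atTop] fun _ => (1 : ℝ) := by
    refine IsBigO.of_bound 1 ?_
    filter_upwards [hxu] with t ht
    simpa using ht
  have h4 := (isLittleO_one_iff ℝ).1 (h2.trans_isBigO h3)
  refine h4.congr fun t => ?_
  simp [mul_sub]

theorem rpow_half_stdDev {ν a y t : ℝ} (hν : 0 < ν) (ha : a < 1) (ht : 0 < t) (i : ℕ) :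
    (ν / (1 - a) ^ 3) ^ ((i : ℝ) / 2) * y ^ i / t ^ (((i : ℝ) - 2) / 2)
      = t * (stdDev ν a * y / √t) ^ i := by
  have h1 : (ν / (1 - a) ^ 3) ^ ((i : ℝ) / 2) = stdDev ν a ^ i := by
    rw [← stdDev_sq hν ha, ← Real.rpow_natCast, ← Real.rpow_mul (stdDev_pos hν ha).le,
      ← Real.rpow_natCast]
    congr 1
    push_cast
    ring
  have h2 : t ^ (((i : ℝ) - 2) / 2) = √t ^ i / t := by
    rw [show ((i : ℝ) - 2) / 2 = 1 / 2 * i - 1 by ring, Real.rpow_sub ht, Real.rpow_one,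
      Real.rpow_mul ht.le, ← Real.sqrt_eq_rpow, Real.rpow_natCast]
  rw [h1, h2, div_pow, mul_pow]
  have : √t ^ i ≠ 0 := pow_ne_zero _ (Real.sqrt_pos.2 ht).ne'
  field_simp

theorem tendsto_div_sqrt_of_isLittleO {m : ℕ} {y : ℕ → ℝ}
    (hy : y =o[atTop] fun t : ℕ => (t : ℝ) ^ ((1 : ℝ) / 2 - 1 / (m : ℝ))) :
    Tendsto (fun t : ℕ => y t / √t) atTop (𝓝 0) := by
  have h1 : (fun t : ℕ => (t : ℝ) ^ ((1 : ℝ) / 2 - 1 / (m : ℝ))) =O[atTop]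
      fun t : ℕ => √(t : ℝ) := by
    refine IsBigO.of_bound 1 ?_
    filter_upwards [eventually_ge_atTop 1] with t ht
    have ht1 : (1 : ℝ) ≤ t := by exact_mod_cast ht
    rw [one_mul, Real.norm_of_nonneg (by positivity), Real.norm_of_nonneg (by positivity),
      Real.sqrt_eq_rpow]
    refine Real.rpow_le_rpow_of_exponent_le ht1 ?_
    have : 0 ≤ 1 / (m : ℝ) := by positivity
    linarith
  exact (hy.trans_isBigO h1).tendsto_div_nhds_zero

/-- The m-th power of t^{1/2 − 1/m} is t^{m/2}/t: the growth condition is made to kill the order m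
term of tI. -/
theorem tendsto_mul_pow_of_isLittleO {m : ℕ} (hm : 0 < m) {y : ℕ → ℝ} (σ : ℝ)
    (hy : y =o[atTop] fun t : ℕ => (t : ℝ) ^ ((1 : ℝ) / 2 - 1 / (m : ℝ))) :
    Tendsto (fun t : ℕ => (t : ℝ) * (σ * y t / √t) ^ m) atTop (𝓝 0) := by
  have h1 := (hy.tendsto_div_nhds_zero.pow m).const_mul (σ ^ m)
  rw [zero_pow hm.ne', mul_zero] at h1
  refine h1.congr' ?_
  filter_upwards [eventually_gt_atTop 0] with t ht
  have ht0 : (0 : ℝ) < t := by exact_mod_cast ht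
  have hm0 : (m : ℝ) ≠ 0 := by exact_mod_cast hm.ne'
  have h2 : ((t : ℝ) ^ ((1 : ℝ) / 2 - 1 / (m : ℝ))) ^ m = √(t : ℝ) ^ m / t := by
    rw [Real.rpow_sub ht0, div_pow, ← Real.sqrt_eq_rpow, one_div, Real.rpow_inv_natCast_pow ht0.le
      hm.ne']
  rw [div_pow, div_pow, h2, mul_pow]
  have : √(t : ℝ) ^ m ≠ 0 := pow_ne_zero _ (Real.sqrt_pos.2 ht0).ne'
  field_simp

/-- Precise moderate deviations, with the rate function in real form. -/
theorem IsHawkes.moderate_deviations {Ω : Type*} [MeasurableSpace Ω] {P : Measure Ω}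
    [IsProbabilityMeasure P] {ν : ℝ≥0} {α : ℕ → ℝ≥0} {X : ℕ → Ω → ℕ} (hX : IsHawkes P ν α X)
    (hν : 0 < ν) (hα0 : α 0 = 0) (hα : Summable α)
    (hiα : Summable fun i : ℕ => (i : ℝ) * (α i : ℝ)) (ha : l1Norm α < 1) {m : ℕ} (hm : 2 ≤ m)
    {y : ℕ → ℝ} (hy : Tendsto y atTop atTop)
    (hyo : y =o[atTop] fun t : ℕ => (t : ℝ) ^ ((1 : ℝ) / 2 - 1 / (m : ℝ))) :
    (fun t : ℕ => P.real {ω | (ν : ℝ) / (1 - l1Norm α) * (t : ℝ)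
        + √t * stdDev ν (l1Norm α) * y t ≤ (count X t ω : ℝ)}) ~[atTop]
      fun t : ℕ => 1 / (y t * √(2 * Real.pi)) * Real.exp (-∑ i ∈ Finset.Ico 2 m,
        iteratedDeriv i (rateReal ν (l1Norm α)) (ν / (1 - l1Norm α)) / (i.factorial : ℝ)
          * (t * (stdDev ν (l1Norm α) * y t / √t) ^ i)) := by
  set a := l1Norm α with hadef
  have ha0 : 0 ≤ a := l1Norm_nonneg α
  have hν' : (0 : ℝ) < ν := hν
  have h1a : 0 < 1 - a := by linarith
  set x₀ : ℝ := ν / (1 - a) with hx₀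
  have hx₀pos : 0 < x₀ := div_pos hν' h1a
  set σ := stdDev ν a with hσ
  have hσpos : 0 < σ := stdDev_pos hν' ha
  have hσsq : σ ^ 2 = ν / (1 - a) ^ 3 := stdDev_sq hν' ha
  set u : ℕ → ℝ := fun t => x₀ + σ * y t / √t with hu
  -- N_t is an integer, so the event is N_t ≥ K for the ceiling K; `u` is the real level per unit
  -- time and `x` the rounded one.
  set K : ℕ → ℕ := fun t => ⌈x₀ * t + √t * σ * y t⌉₊ with hK
  set x : ℕ → ℝ := fun t => K t / t with hx
  have hrt : Tendsto (fun t : ℕ => √(t : ℝ)) atTop atTop :=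
    Real.tendsto_sqrt_atTop.comp tendsto_natCast_atTop_atTop
  have hpos : ∀ᶠ t : ℕ in atTop, 0 < (t : ℝ) := by
    filter_upwards [eventually_gt_atTop 0] with t ht
    exact_mod_cast ht
  have hulim : Tendsto u atTop (𝓝 x₀) := by
    have h := ((tendsto_div_sqrt_of_isLittleO hyo).const_mul σ).const_add x₀
    simpa [hu, mul_div_assoc] using h
  have hround : ∀ᶠ t : ℕ in atTop, 0 ≤ t * (x t - u t) ∧ t * (x t - u t) ≤ 1 := by
    filter_upwards [hpos, hy.eventually_ge_atTop 0] with t ht hyt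
    have hl : 0 ≤ x₀ * t + √t * σ * y t := by positivity
    have h1 : t * (x t - u t) = K t - (x₀ * t + √t * σ * y t) := by
      have hs : √(t : ℝ) * √(t : ℝ) = t := Real.mul_self_sqrt ht.le
      have hs0 : √(t : ℝ) ≠ 0 := (Real.sqrt_pos.2 ht).ne'
      have h2 : (t : ℝ) * (σ * y t / √t) = √t * σ * y t := by
        nth_rw 1 [← hs]
        field_simp
      have h3 : (t : ℝ) * (K t / t) = K t := mul_div_cancel₀ _ ht.ne'
      rw [hx, hu]
      linear_combination h3 - h2
    rw [h1]
    exact ⟨sub_nonneg.2 (Nat.le_ceil _), by linarith [Nat.ceil_lt_add_one hl]⟩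
  have hxulim : Tendsto (fun t : ℕ => √t * (x t - u t)) atTop (𝓝 0) := by
    refine squeeze_zero' (g := fun t : ℕ => (√(t : ℝ))⁻¹) ?_ ?_ (tendsto_inv_atTop_zero.comp hrt)
    · filter_upwards [hround, hpos] with t h1 ht
      exact mul_nonneg (Real.sqrt_nonneg _) (nonneg_of_mul_nonneg_right h1.1 ht)
    · filter_upwards [hround, hpos] with t h1 ht
      have hs : √(t : ℝ) * √(t : ℝ) = t := Real.mul_self_sqrt ht.le
      rw [← one_div, le_div_iff₀ (Real.sqrt_pos.2 ht)]
      calc _ = √(t : ℝ) * √(t : ℝ) * (x t - u t) := by ring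
        _ ≤ 1 := by rw [hs]; exact h1.2
  have hxlim : Tendsto x atTop (𝓝 x₀) := by
    have h := hulim.add (hxulim.mul (tendsto_inv_atTop_zero.comp hrt))
    rw [mul_zero, add_zero] at h
    refine h.congr' ?_
    filter_upwards [hpos] with t ht
    have hs0 : √(t : ℝ) ≠ 0 := (Real.sqrt_pos.2 ht).ne'
    simp only [Function.comp]
    field_simp
    ring
  have hgap : Tendsto (fun t : ℕ => √t * (x t - x₀) / y t) atTop (𝓝 σ) := by
    have h := (hxulim.mul (tendsto_inv_atTop_zero.comp hy)).const_add σ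
    rw [mul_zero, add_zero] at h
    refine h.congr' ?_
    filter_upwards [hpos, hy.eventually_gt_atTop 0] with t ht hyt
    have hs0 : √(t : ℝ) ≠ 0 := (Real.sqrt_pos.2 ht).ne'
    have h1 : √(t : ℝ) * (u t - x₀) = σ * y t := by
      rw [hu]
      field_simp
      ring
    have h2 : √(t : ℝ) * (x t - x₀) = √t * (x t - u t) + σ * y t := by linear_combination h1
    simp only [Function.comp]
    rw [h2]
    field_simp
    ring
  have hne : ∀ᶠ t in atTop, x t ≠ x₀ := by
    filter_upwards [hgap.eventually (lt_mem_nhds hσpos)] with t ht h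
    rw [h, sub_self, mul_zero, zero_div] at ht
    exact lt_irrefl _ ht
  have hsad₀ := tendsto_saddle_div hν' ha0 ha hxlim hne
  rw [← hx₀] at hsad₀
  -- I'(x) ≈ I''(x₀)(x − x₀) with I''(x₀) = σ⁻² and √t(x − x₀) ≈ σy; so √t·I'(x) ~ y/σ, which
  -- diverges as `tendsto_tail` requires.
  have hsad : Tendsto (fun t : ℕ => √t * saddle ν a (x t) / y t) atTop (𝓝 σ⁻¹) := by
    have h := hsad₀.mul hgap
    have hval : (1 - a) ^ 3 / ν * σ = σ⁻¹ := by
      have h2 : (1 - a) ^ 3 / ν = (σ ^ 2)⁻¹ := by rw [hσsq, inv_div]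
      rw [h2]
      field_simp
    rw [hval] at h
    refine h.congr' ?_
    filter_upwards [hne] with t ht
    have := sub_ne_zero.2 ht
    field_simp
  have hr : Tendsto (fun t : ℕ => √t * saddle ν a (x t)) atTop atTop := by
    refine (hsad.pos_mul_atTop (inv_pos.2 hσpos) hy).congr' ?_
    filter_upwards [hy.eventually_ne_atTop 0] with t ht
    exact div_mul_cancel₀ _ ht
  have hKx : ∀ᶠ t in atTop, (K t : ℝ) = t * x t := by
    filter_upwards [hpos] with t ht
    rw [hx, mul_div_cancel₀ _ ht.ne']
  have htail := hX.tendsto_tail hν hα0 hα hiα ha hKx hxlim hr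
  have hrate := tendsto_mul_rateReal_sub hν' ha0 ha hxlim hulim (by
    filter_upwards [hround] with t ht
    rw [abs_of_nonneg ht.1]
    exact ht.2)
  have htay := tendsto_mul_rateReal_sub_taylor hν' ha0 ha hm hulim (by
    simpa [hu, ← hx₀] using tendsto_mul_pow_of_isLittleO (by omega) σ hyo)
  rw [← hx₀] at htay
  rw [← hadef] at htail
  set S : ℕ → ℝ := fun t => ∑ i ∈ Finset.Ico 2 m, iteratedDeriv i (rateReal ν a) x₀ /
    (i.factorial : ℝ) * (t * (σ * y t / √t) ^ i) with hS
  have hexp : Tendsto (fun t : ℕ => Real.exp (S t - t * rateReal ν a (x t))) atTop (𝓝 1) := by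
    have h := (hrate.add htay).neg
    rw [add_zero, neg_zero] at h
    have h2 := (Real.continuous_exp.tendsto 0).comp h
    rw [Real.exp_zero] at h2
    refine h2.congr fun t => ?_
    simp only [Function.comp, hS, hu, add_sub_cancel_left]
    congr 1
    ring
  have hpi := Real.pi_pos
  have hev : ∀ᶠ t in atTop, 1 / (y t * √(2 * Real.pi)) * Real.exp (-S t) ≠ 0 := by
    filter_upwards [hy.eventually_gt_atTop 0] with t ht
    positivity
  rw [isEquivalent_iff_tendsto_one hev]
  -- The tail constant is 1/(σ√(2π)); replacing √t·I'(x) by y brings a factor σ, and the limit of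
  -- the ratio is 1.
  have hall := ((htail.mul (hsad.inv₀ (inv_pos.2 hσpos).ne')).mul hexp).mul_const √(2 * Real.pi)
  have hval : √(Real.pi / (ν / (1 - a) ^ 3 / 2)) / (2 * Real.pi) * σ⁻¹⁻¹ * 1 * √(2 * Real.pi)
      = 1 := by
    rw [← hσsq, show Real.pi / (σ ^ 2 / 2) = 2 * Real.pi / σ ^ 2 by field_simp,
      Real.sqrt_div' _ (by positivity), Real.sqrt_sq hσpos.le, inv_inv, mul_one]
    have hs : √(2 * Real.pi) * √(2 * Real.pi) = 2 * Real.pi := Real.mul_self_sqrt (by positivity)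
    field_simp
    nlinarith [hs]
  rw [hval] at hall
  refine hall.congr' ?_
  filter_upwards [hy.eventually_gt_atTop 0, hr.eventually_gt_atTop 0] with t hyt hrt0
  have hset : {ω | x₀ * (t : ℝ) + √t * σ * y t ≤ (count X t ω : ℝ)}
      = {ω | K t ≤ count X t ω} := by
    ext ω
    exact (Nat.ceil_le (a := x₀ * t + √t * σ * y t) (n := count X t ω)).symm
  simp only [Pi.div_apply]
  rw [hset, Real.exp_sub, Real.exp_neg]
  have h2 : √(2 * Real.pi) ≠ 0 := by positivity
  have h3 := Real.exp_ne_zero (t * rateReal ν a (x t))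
  have h4 := Real.exp_ne_zero (S t)
  have h5 := hrt0.ne'
  have h6 := left_ne_zero_of_mul h5
  have h7 := right_ne_zero_of_mul h5
  field_simp

end ModerateDeviations

end DiscreteHawkes

theorem mainTheorem2 {Ω : Type*} [MeasurableSpace Ω] (P : Measure Ω) [IsProbabilityMeasure P]
    (ν : ℝ≥0) (hν : 0 < ν) (α : ℕ → ℝ≥0) (hα0 : α 0 = 0) (hα : Summable α)
    (X : ℕ → Ω → ℕ) (hX : DiscreteHawkes.IsHawkes P ν α X) :
    -- the derivatives of the rate function
    (∀ x : ℝ, 0 < x →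
      ContDiffAt ℝ ((⊤ : ℕ∞) : WithTop ℕ∞) (fun u => (DiscreteHawkes.rate ν α u).toReal) x ∧
      ∀ i : ℕ, 2 ≤ i →
        iteratedDeriv i (fun u => (DiscreteHawkes.rate ν α u).toReal) x =
          ((i - 2).factorial : ℝ) * (-1) ^ (i - 2) * x ^ (1 - (i : ℤ)) *
            (((i : ℝ) - 1) *
                (DiscreteHawkes.l1Norm α * x / (ν + DiscreteHawkes.l1Norm α * x)) ^ i
              - (i : ℝ) *
                (DiscreteHawkes.l1Norm α * x / (ν + DiscreteHawkes.l1Norm α * x)) ^ (i - 1)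
              + 1)) ∧
    (DiscreteHawkes.l1Norm α < 1 →
      -- the limit defining `η` exists near `0`, and the values of `η'(0)` and `η''(0)`
      ((∀ᶠ z : ℂ in 𝓝 0, Tendsto (fun s => DiscreteHawkes.f α z s) atTop
          (𝓝 (DiscreteHawkes.fInf α z))) ∧
        AnalyticAt ℂ (DiscreteHawkes.eta ν α) 0 ∧
        deriv (DiscreteHawkes.eta ν α) 0 =
          (((ν : ℝ) / (1 - DiscreteHawkes.l1Norm α) : ℝ) : ℂ) ∧
        iteratedDeriv 2 (DiscreteHawkes.eta ν α) 0 =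
          (((ν : ℝ) / (1 - DiscreteHawkes.l1Norm α) ^ 3 : ℝ) : ℂ)) ∧
      -- the precise moderate deviations
      (Summable (fun i : ℕ => (i : ℝ) * (α i : ℝ)) →
        ∀ m : ℕ, 3 ≤ m → ∀ y : ℕ → ℝ, Tendsto y atTop atTop →
          y =o[atTop] (fun t : ℕ => (t : ℝ) ^ ((1 : ℝ) / 2 - 1 / (m : ℝ))) →
          (fun t : ℕ => P.real {ω |
              (ν : ℝ) / (1 - DiscreteHawkes.l1Norm α) * (t : ℝ)
                + Real.sqrt t
                  * (Real.sqrt ν / (1 - DiscreteHawkes.l1Norm α) ^ ((3 : ℝ) / 2)) * y t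
              ≤ (DiscreteHawkes.count X t ω : ℝ)})
            ~[atTop]
          (fun t : ℕ => 1 / (y t * Real.sqrt (2 * Real.pi)) *
            Real.exp (-∑ i ∈ Finset.Ico 2 m,
              iteratedDeriv i (fun u => (DiscreteHawkes.rate ν α u).toReal)
                  (deriv (DiscreteHawkes.eta ν α) 0).re / (i.factorial : ℝ)
                * ((iteratedDeriv 2 (DiscreteHawkes.eta ν α) 0).re ^ ((i : ℝ) / 2) * y t ^ i
                  / (t : ℝ) ^ (((i : ℝ) - 2) / 2)))))) := by
  refine ⟨fun x hx => DiscreteHawkes.rate_derivatives hν α hx, fun ha => ?_⟩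
  obtain ⟨han, hd1, hd2⟩ := DiscreteHawkes.eta_local ν hα0 hα ha
  refine ⟨⟨(DiscreteHawkes.fInf_local hα0 hα ha).1.mono fun z h => h.1, han, hd1, hd2⟩,
    fun hiα m hm y hy hyo => ?_⟩
  have hν' : (0 : ℝ) < ν := hν
  have hx₀ : 0 < (ν : ℝ) / (1 - DiscreteHawkes.l1Norm α) := div_pos hν' (by linarith)
  refine (hX.moderate_deviations hν hα0 hα hiα ha (by omega) hy hyo).congr_right ?_
  -- Positivity of t is needed to turn the real powers of t and η''(0) into powers of σy/√t.
  filter_upwards [eventually_gt_atTop 0] with t ht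
  rw [hd1, hd2, Complex.ofReal_re, Complex.ofReal_re]
  congr 3
  refine Finset.sum_congr rfl fun i _ => ?_
  rw [(DiscreteHawkes.rate_toReal_eventuallyEq ν α hx₀).iteratedDeriv_eq,
    DiscreteHawkes.rpow_half_stdDev hν' ha (by exact_mod_cast ht)]
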